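/- Let $d\ge 2$, let $\xi^-\ne\xi^+$ be two points of the unit sphere $\mathbb S^{d-1}\subset\mathbb R^d$ and let $V_{\min}>0$. Let $\mathcal S$ be the set of all $V\in C^2(\mathbb S^{d-1})$ such that $V(s)\ge V(\xi^\pm)=V_{\min}$ for every $s\in\mathbb S^{d-1}$ and such that, for some $\delta,\mu>0$, $V(s)-V_{\min}\ge\mu|s-\xi^{\pm}|^2$ whenever $|s-\xi^\pm|<\delta$. For $V\in\mathcal S$ and $\alpha\in(0,2)$ extend $V$ to $\mathbb R^d$ by $V_\alpha(x)=V(x/|x|)/|x|^{\alpha}$ for $x\neq0$ and $V_\alpha(0)=+\infty$. For $0\le\varepsilon\le1$ let $$m((V,\alpha),\varepsilon)=\inf\int_{-T}^{T}\Big(\tfrac12|\dot x(t)|^2+V_\alpha(x(t))\Big)\,dt,$$ where the infimum is over all $T>0$ and all $x\in H^1((-T,T);\mathbb R^d)$ with $x(-T)=\xi^-$, $x(T)=\xi^+$ and $\min_{[-T,T]}|x|=\varepsilon$. For $0<\varepsilon\le1$ put $$\gamma((V,\alpha),\varepsilon)=\frac{m((V,\alpha),\varepsilon)-m((V,\alpha),0)}{\varepsilon^{(2-\alpha)/2}},\qquad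 \gamma((V,\alpha),0^+)=\lim_{\varepsilon\to0^+}\gamma((V,\alpha),\varepsilon),\qquad \gamma((V,0^+),0^+)=\lim_{\alpha\to0^+}\gamma((V,\alpha),0^+),$$ and let $\Sigma=\{V\in\mathcal S:\gamma((V,0^+),0^+)>0\}$. Then: (i) for every $V\in\mathcal S$ these quantities are well defined: $m((V,\alpha),\varepsilon)$ is finite for all $\alpha\in(0,2)$ and $\varepsilon\in[0,1]$, and both limits above (the first for every $\alpha\in(0,2)$) exist and are finite; (ii) for every $V\in\mathcal S$ and $0<\alpha_1<\alpha_2<2$, $$\gamma((V,\alpha_2),0^+)-\gamma((V,\alpha_1),0^+)\le-\frac{4\sqrt{2V_{\min}}}{(2-\alpha_1)^2}(\alpha_2-\alpha_1);$$ (iii) for every $V\in\mathcal S$, $\gamma((V,\alpha),0^+)\to-\infty$ as $\alpha\to2^-$; (iv) for every $V\in\Sigma$ there is exactly one $\bar\alpha=\bar\alpha(V)\in(0,2)$ with $\gamma((V,\bar\alpha),0^+)=0$. -/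

import Mathlib

open Set Filter Topology MeasureTheory
open scoped ENNReal Manifold

noncomputable section

/-- The Euclidean space `ℝ^d` with `d = n + 1`. -/
abbrev Space (n : ℕ) : Type := EuclideanSpace ℝ (Fin (n + 1))

/-- The unit sphere of `ℝ^(n+1)`. -/
abbrev Sph (n : ℕ) : Type := Metric.sphere (0 : Space n) 1

/-- The class `𝒮` attached to two points `ξm`, `ξp` of the sphere and a level `Vmin`: the `C²`
functions on the sphere whose global minimum `Vmin` is attained, non-degenerately, at `ξm`
and `ξp`. -/
structure IsAdmissible {n : ℕ} (ξm ξp : Sph n) (Vmin : ℝ) (V : Sph n → ℝ) : Prop where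
  contMDiff : ContMDiff (𝓡 n) 𝓘(ℝ, ℝ) 2 V
  value_left : V ξm = Vmin
  value_right : V ξp = Vmin
  le_value : ∀ s : Sph n, Vmin ≤ V s
  nondegenerate : ∃ δ > 0, ∃ μ > 0, ∀ s : Sph n,
    (‖(s : Space n) - ξm‖ < δ → μ * ‖(s : Space n) - ξm‖ ^ 2 ≤ V s - Vmin) ∧
    (‖(s : Space n) - ξp‖ < δ → μ * ‖(s : Space n) - ξp‖ ^ 2 ≤ V s - Vmin)

/-- The radial projection `x / |x|` of a nonzero vector to the sphere. -/
def direction {n : ℕ} (x : Space n) (hx : x ≠ 0) : Sph n :=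
  ⟨‖x‖⁻¹ • x, by simp [norm_smul, hx]⟩

open Classical in
/-- The `-α`-homogeneous extension `V(x/|x|) / |x|^α` of a positive function on the sphere; it is
`+∞` at the origin. -/
def potential {n : ℕ} (V : Sph n → ℝ) (α : ℝ) (x : Space n) : ℝ≥0∞ :=
  if hx : x = 0 then ⊤ else ENNReal.ofReal (V (direction x hx) / ‖x‖ ^ α)

/-- `x` is (the continuous representative of) an element of `H¹((a,b); ℝ^(n+1))` with weak
derivative `v`: `v` is in `L²` and `x` is a primitive of `v` on `[a,b]`. -/
structure IsH1Path {n : ℕ} (a b : ℝ) (x v : ℝ → Space n) : Prop where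
  memLp : MemLp v 2 (volume.restrict (Icc a b))
  eq_integral : ∀ t ∈ Icc a b, x t = x a + ∫ τ in a..t, v τ

/-- The (possibly infinite) Lagrangian action on `[a,b]` of the path `x` with derivative `v`. -/
def action {n : ℕ} (V : Sph n → ℝ) (α a b : ℝ) (x v : ℝ → Space n) : ℝ≥0∞ :=
  ∫⁻ t in Icc a b, (ENNReal.ofReal (‖v t‖ ^ 2 / 2) + potential V α (x t))

/-- The `ε`-constrained paths on `[-T,T]` from `x₁` to `x₂`: those `H¹` paths (with derivative `v`)
for which `min |x(t)| = ε`. -/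
structure IsConstrainedPath {n : ℕ} (T : ℝ) (x₁ x₂ : Space n) (ε : ℝ) (x v : ℝ → Space n) :
    Prop where
  h1 : IsH1Path (-T) T x v
  left : x (-T) = x₁
  right : x T = x₂
  isLeast : IsLeast ((fun t => ‖x t‖) '' Icc (-T) T) ε

/-- The set of actions of all `ε`-constrained paths from `x₁` to `x₂`, over all `T > 0`. -/
def actionLevels {n : ℕ} (V : Sph n → ℝ) (α : ℝ) (x₁ x₂ : Space n) (ε : ℝ) : Set ℝ≥0∞ :=
  {A | ∃ T > 0, ∃ x v : ℝ → Space n,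
    IsConstrainedPath T x₁ x₂ ε x v ∧ A = action V α (-T) T x v}

/-- The constrained Bolza level `m((V,α),ε)` between `ξm` and `ξp`, as an extended number. -/
def bolzaLevel {n : ℕ} (ξm ξp : Sph n) (V : Sph n → ℝ) (α ε : ℝ) : ℝ≥0∞ :=
  sInf (actionLevels V α ξm ξp ε)

/-- `γ((V,α),ε) = (m((V,α),ε) - m((V,α),0)) / ε^(α_*)` with `α_* = (2 - α)/2`. -/
def gammaFun {n : ℕ} (ξm ξp : Sph n) (V : Sph n → ℝ) (α ε : ℝ) : ℝ :=
  ((bolzaLevel ξm ξp V α ε).toReal - (bolzaLevel ξm ξp V α 0).toReal) / ε ^ ((2 - α) / 2)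

/-- `γ((V,α),0⁺)`, the limit of `γ((V,α),ε)` as `ε → 0⁺`. -/
def gammaZero {n : ℕ} (ξm ξp : Sph n) (V : Sph n → ℝ) (α : ℝ) : ℝ :=
  limUnder (𝓝[>] (0 : ℝ)) (fun ε => gammaFun ξm ξp V α ε)

/-- `γ((V,0⁺),0⁺)`, the limit of `γ((V,α),0⁺)` as `α → 0⁺`. -/
def gammaZeroZero {n : ℕ} (ξm ξp : Sph n) (V : Sph n → ℝ) : ℝ :=
  limUnder (𝓝[>] (0 : ℝ)) (fun α => gammaZero ξm ξp V α)

/-- The set `Σ` of the admissible `V` with `γ((V,0⁺),0⁺) > 0`. -/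
def SigmaSet {n : ℕ} (ξm ξp : Sph n) (Vmin : ℝ) : Set (Sph n → ℝ) :=
  {V | IsAdmissible ξm ξp Vmin V ∧ 0 < gammaZeroZero ξm ξp V}

end

/-! Put `β = (2 - α)/2`. Then `V_α = J²/2` with `J = √(2V(x/|x|)) |x|^(β-1)`, so the action is at
least the Jacobi length `∫ J |x'|` by the arithmetic-geometric inequality, and a change of time
brings the two as close as desired. Hence every level `m` is an infimum of Jacobi lengths; for `ε =
0` two radial segments are optimal and `m = 2√(2Vmin)/β`.

The Jacobi length is homogeneous of degree `β` under dilations. Blowing up by `1/ε` gives curves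
between `ξm/ε` and `ξp/ε` at distance `1` from the origin. Subtract the length of two rays from
radius `1` to the end radius: this excess does not change when the curve is prolonged along the rays
of `ξm` and `ξp`, so `γ((V,α),ε)` tends to `G(β) - 2√(2Vmin)/β`, where `G = minExcess` is the
infimum of the excess over all radii.

The excess is the integral of `|x|^(β-1)` against a nonnegative density free of `β`, over a curve
with `|x| ≥ 1`; so `G` is nondecreasing in `β` (`minExcess_mono`). The term `-4√(2Vmin)/(2-α)` then
gives both the rate of decrease and the divergence at `α = 2`. Conversely, the map `x ↦ |x|^(p-1) x`
with `p = β/β' ≤ 1` yields `(β/β') G(β') ≤ G(β)` for `β ≤ β'` (`mul_minExcess_le`). The two bounds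
make `G` continuous on `β > 0`, which provides the limit at `α = 0` and, with strict monotonicity,
the unique zero. -/

noncomputable section

/-! ### Absolutely continuous curves: chain rule and concatenation -/

/-- `x` is absolutely continuous on `[a,b]` with integrable derivative `v`. -/
structure IsCurve {E : Type*} [NormedAddCommGroup E] [NormedSpace ℝ E] (a b : ℝ) (x v : ℝ → E) :
    Prop where
  lt : a < b
  integrable : IntervalIntegrable v volume a b
  eq_integral : ∀ t ∈ Icc a b, x t = x a + ∫ τ in a..t, v τ

namespace IsCurve

variable {E F : Type*} [NormedAddCommGroup E] [NormedSpace ℝ E]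
  [NormedAddCommGroup F] [NormedSpace ℝ F] {a b : ℝ} {x v : ℝ → E}

theorem integrable_sub (h : IsCurve a b x v) {s t : ℝ} (hs : s ∈ Icc a b) (ht : t ∈ Icc a b) :
    IntervalIntegrable v volume s t :=
  h.integrable.mono_set (by rw [uIcc_of_le h.lt.le]; exact uIcc_subset_Icc hs ht)

theorem sub_eq (h : IsCurve a b x v) {s t : ℝ} (hs : s ∈ Icc a b) (ht : t ∈ Icc a b) :
    x t - x s = ∫ τ in s..t, v τ := by
  have ha : a ∈ Icc a b := ⟨le_rfl, h.lt.le⟩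
  rw [h.eq_integral t ht, h.eq_integral s hs,
    ← intervalIntegral.integral_add_adjacent_intervals (h.integrable_sub ha hs)
      (h.integrable_sub hs ht)]
  abel

theorem continuousOn (h : IsCurve a b x v) : ContinuousOn x (Icc a b) := by
  have h1 : ContinuousOn (fun t => x a + ∫ τ in a..t, v τ) (Icc a b) := by
    refine continuousOn_const.add ?_
    have := intervalIntegral.continuousOn_primitive_interval (μ := volume) (f := v) (a := a)
      (b := b) ((intervalIntegrable_iff' (by simp)|>.1 h.integrable))
    rwa [uIcc_of_le h.lt.le] at this
  exact h1.congr h.eq_integral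

theorem norm_sub_le (h : IsCurve a b x v) {s t : ℝ} (hs : s ∈ Icc a b) (ht : t ∈ Icc a b)
    (hst : s ≤ t) : ‖x t - x s‖ ≤ ∫ τ in s..t, ‖v τ‖ := by
  rw [h.sub_eq hs ht]
  exact intervalIntegral.norm_integral_le_integral_norm hst

/-- The product of a continuous family of linear maps with an integrable function. -/
theorem intervalIntegrable_clm_apply {f' : ℝ → E →L[ℝ] F} (hab : a ≤ b)
    (hf' : ContinuousOn f' (Icc a b)) (hv : IntervalIntegrable v volume a b) :
    IntervalIntegrable (fun t => f' t (v t)) volume a b := by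
  obtain ⟨C, hC⟩ := isCompact_Icc.exists_bound_of_continuousOn hf'
  have hv' : IntegrableOn v (Icc a b) := (intervalIntegrable_iff_integrableOn_Icc_of_le hab).1 hv
  rw [intervalIntegrable_iff_integrableOn_Icc_of_le hab]
  refine Integrable.mono' (hv'.norm.const_mul C) ?_ ?_
  · exact (ContinuousLinearMap.id ℝ (E →L[ℝ] F)).aestronglyMeasurable_comp₂
      (hf'.aestronglyMeasurable_of_isCompact isCompact_Icc measurableSet_Icc)
      hv'.aestronglyMeasurable
  · filter_upwards [ae_restrict_mem measurableSet_Icc] with t ht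
    exact ((f' t).le_opNorm _).trans (mul_le_mul_of_nonneg_right (hC t ht) (norm_nonneg _))

/-- Chain rule for absolutely continuous curves. -/
theorem comp [CompleteSpace E] [CompleteSpace F] (h : IsCurve a b x v) {f : E → F} {f' : E → E →L[ℝ] F}
    (hf : ∀ t ∈ Icc a b, HasFDerivAt f (f' (x t)) (x t))
    (hf' : ContinuousOn (fun t => f' (x t)) (Icc a b)) :
    IsCurve a b (fun t => f (x t)) (fun t => f' (x t) (v t)) := by
  have hint := intervalIntegrable_clm_apply h.lt.le hf' h.integrable
  refine ⟨h.lt, hint, ?_⟩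
  have hsub : ∀ {s t : ℝ}, s ∈ Icc a b → t ∈ Icc a b →
      IntervalIntegrable (fun t => f' (x t) (v t)) volume s t := fun hs ht =>
    hint.mono_set (by rw [uIcc_of_le h.lt.le]; exact uIcc_subset_Icc hs ht)
  have ha : a ∈ Icc a b := ⟨le_rfl, h.lt.le⟩
  -- The defect in the claimed identity. It is shown to vanish by continuous induction along
  -- `[a,b]`, without differentiating almost everywhere.
  set g : ℝ → F := fun t => f (x t) - f (x a) - ∫ τ in a..t, f' (x τ) (v τ) with hg
  have hxc := h.continuousOn
  have hfc : ContinuousOn (fun t => f (x t)) (Icc a b) := fun t ht =>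
    (hf t ht).continuousAt.comp_continuousWithinAt (hxc t ht)
  have hgc : ContinuousOn g (Icc a b) := by
    refine (hfc.sub continuousOn_const).sub ?_
    have := intervalIntegral.continuousOn_primitive_interval (μ := volume)
      (f := fun t => f' (x t) (v t)) (a := a) (b := b) (intervalIntegrable_iff' (by simp)|>.1 hint)
    rwa [uIcc_of_le h.lt.le] at this
  have hVc : ContinuousOn (fun t => ∫ τ in a..t, ‖v τ‖) (Icc a b) := by
    have := intervalIntegral.continuousOn_primitive_interval (μ := volume)
      (f := fun t => ‖v t‖) (a := a) (b := b) (intervalIntegrable_iff' (by simp)|>.1 h.integrable.norm)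
    rwa [uIcc_of_le h.lt.le] at this
  have key : ∀ η > 0, ∀ t ∈ Icc a b, ‖g t‖ ≤ η * ∫ τ in a..t, ‖v τ‖ := by
    intro η hη
    have hcl : IsClosed ({t | ‖g t‖ ≤ η * ∫ τ in a..t, ‖v τ‖} ∩ Icc a b) := by
      have : IsClosed {t ∈ Icc a b | ‖g t‖ ≤ η * ∫ τ in a..t, ‖v τ‖} :=
        isClosed_Icc.isClosed_le hgc.norm (continuousOn_const.mul hVc)
      convert this using 1
      ext t; simp [and_comm]
    refine hcl.Icc_subset_of_forall_exists_gt (by simp [hg]) ?_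
    rintro t ⟨ht, htI⟩ y hy
    have htI' : t ∈ Icc a b := ⟨htI.1, htI.2.le⟩
    have e1 : ∀ᶠ z in 𝓝 (x t), ‖f z - f (x t) - f' (x t) (z - x t)‖ ≤ η / 2 * ‖z - x t‖ :=
      (hf t htI').isLittleO.def (half_pos hη)
    have e2 : ∀ᶠ s in 𝓝[Icc a b] t, ‖f (x s) - f (x t) - f' (x t) (x s - x t)‖ ≤
        η / 2 * ‖x s - x t‖ := (hxc t htI').eventually e1
    have e3 : ∀ᶠ s in 𝓝[Icc a b] t, ‖f' (x s) - f' (x t)‖ < η / 2 := by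
      have := (hf' t htI').eventually (Metric.ball_mem_nhds _ (half_pos hη))
      simpa [Metric.mem_ball, dist_eq_norm] using this
    obtain ⟨δ, hδ, hball⟩ := Metric.mem_nhdsWithin_iff.1 (e2.and e3)
    set s := min (min y b) (t + δ / 2) with hs
    have hts : t < s := lt_min (lt_min hy htI.2) (by linarith)
    have hsb : s ≤ b := (min_le_left _ _).trans (min_le_right _ _)
    have hsy : s ≤ y := (min_le_left _ _).trans (min_le_left _ _)
    have hsδ : s ≤ t + δ / 2 := min_le_right _ _
    have hsI : s ∈ Icc a b := ⟨htI.1.trans hts.le, hsb⟩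
    have hmem : ∀ r ∈ Icc t s, r ∈ Metric.ball t δ ∩ Icc a b := fun r hr =>
      ⟨by rw [Metric.mem_ball, Real.dist_eq, abs_of_nonneg (by linarith [hr.1])]
          linarith [hr.2], htI.1.trans hr.1, hr.2.trans hsb⟩
    refine ⟨s, ?_, hts, hsy⟩
    have hV : ∫ τ in a..s, ‖v τ‖ = (∫ τ in a..t, ‖v τ‖) + ∫ τ in t..s, ‖v τ‖ :=
      (intervalIntegral.integral_add_adjacent_intervals (h.integrable_sub ha htI').norm
        (h.integrable_sub htI' hsI).norm).symm
    have hG : ∫ τ in a..s, f' (x τ) (v τ) =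
        (∫ τ in a..t, f' (x τ) (v τ)) + ∫ τ in t..s, f' (x τ) (v τ) :=
      (intervalIntegral.integral_add_adjacent_intervals (hsub ha htI') (hsub htI' hsI)).symm
    have hlin : f' (x t) (x s - x t) = ∫ τ in t..s, f' (x t) (v τ) := by
      rw [h.sub_eq htI' hsI]
      exact ((f' (x t)).intervalIntegral_comp_comm (h.integrable_sub htI' hsI)).symm
    -- The increment of the defect is the linearisation error of `f` at `x t` minus the effect of
    -- the variation of `f'`; each is at most `η/2` times the length of the short arc.
    have hdec : g s - g t = (f (x s) - f (x t) - f' (x t) (x s - x t)) -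
        ∫ τ in t..s, (f' (x τ) - f' (x t)) (v τ) := by
      have : ∫ τ in t..s, (f' (x τ) - f' (x t)) (v τ) =
          (∫ τ in t..s, f' (x τ) (v τ)) - ∫ τ in t..s, f' (x t) (v τ) := by
        rw [← intervalIntegral.integral_sub (hsub htI' hsI)]
        · rfl
        · exact intervalIntegrable_clm_apply hts.le continuousOn_const
            (h.integrable_sub htI' hsI)
      rw [this, ← hlin]
      simp only [hg, hG]
      abel
    have hb2 : ‖∫ τ in t..s, (f' (x τ) - f' (x t)) (v τ)‖ ≤ η / 2 * ∫ τ in t..s, ‖v τ‖ := by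
      rw [← intervalIntegral.integral_const_mul]
      refine intervalIntegral.norm_integral_le_of_norm_le hts.le (ae_of_all _ fun r hr => ?_)
        ((h.integrable_sub htI' hsI).norm.const_mul _)
      refine (ContinuousLinearMap.le_opNorm _ _).trans
        (mul_le_mul_of_nonneg_right ?_ (norm_nonneg _))
      exact (hball (hmem r ⟨hr.1.le, hr.2⟩)).2.le
    have hb1 := (hball (hmem s ⟨hts.le, le_rfl⟩)).1
    have hb3 := h.norm_sub_le htI' hsI hts.le
    have : ‖g s‖ ≤ ‖g t‖ + ‖g s - g t‖ := by
      simpa using norm_add_le (g t) (g s - g t)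
    have h4 : ‖g s - g t‖ ≤ η * ∫ τ in t..s, ‖v τ‖ := by
      rw [hdec]
      refine (_root_.norm_sub_le _ _).trans ?_
      have := mul_le_mul_of_nonneg_left hb3 (half_pos hη).le
      linarith
    change ‖g t‖ ≤ _ at ht
    change ‖g s‖ ≤ _
    rw [hV, mul_add]
    linarith
  intro t ht
  have hz : ‖g t‖ ≤ 0 := by
    refine le_of_forall_pos_le_add fun ε hε => ?_
    have hV0 : 0 ≤ ∫ τ in a..t, ‖v τ‖ :=
      intervalIntegral.integral_nonneg ht.1 fun _ _ => norm_nonneg _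
    refine (key (ε / ((∫ τ in a..t, ‖v τ‖) + 1)) (by positivity) t ht).trans ?_
    rw [zero_add, div_mul_eq_mul_div, div_le_iff₀ (by positivity)]
    nlinarith
  have := norm_le_zero_iff.1 hz
  rw [hg] at this
  simp only [sub_eq_zero] at this
  rw [← this]; abel

/-- Concatenation of two curves. -/
theorem concat {c : ℝ} {y w : ℝ → E} (h : IsCurve a b x v) (h' : IsCurve b c y w)
    (hxy : x b = y b) :
    IsCurve a c (fun t => if t ≤ b then x t else y t) (fun t => if t ≤ b then v t else w t) := by
  have i1 : IntervalIntegrable (fun t => if t ≤ b then v t else w t) volume a b :=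
    h.integrable.congr fun t ht => by
      rw [uIoc_of_le h.lt.le] at ht
      simp [ht.2]
  have i2 : IntervalIntegrable (fun t => if t ≤ b then v t else w t) volume b c :=
    h'.integrable.congr fun t ht => by
      rw [uIoc_of_le h'.lt.le] at ht
      simp [ht.1]
  refine ⟨h.lt.trans h'.lt, i1.trans i2, fun t ht => ?_⟩
  have e1 : ∀ s ≤ b, a ≤ s → ∫ τ in a..s, (if τ ≤ b then v τ else w τ) = ∫ τ in a..s, v τ :=
    fun s hs has => intervalIntegral.integral_congr_ae (ae_of_all _ fun τ hτ => by
      rw [uIoc_of_le has] at hτ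
      simp [hτ.2.trans hs])
  simp only [h.lt.le, if_true]
  split_ifs with htb
  · rw [e1 t htb ht.1]
    exact h.eq_integral t ⟨ht.1, htb⟩
  · push Not at htb
    have e2 : ∫ τ in b..t, (if τ ≤ b then v τ else w τ) = ∫ τ in b..t, w τ :=
      intervalIntegral.integral_congr_ae (ae_of_all _ fun τ hτ => by
        rw [uIoc_of_le htb.le] at hτ
        simp [hτ.1])
    rw [← intervalIntegral.integral_add_adjacent_intervals i1
      (i2.mono_set (by
        rw [uIcc_of_le h'.lt.le, uIcc_of_le htb.le]; exact Icc_subset_Icc_right ht.2)),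
      e1 b le_rfl h.lt.le, e2, h'.eq_integral t ⟨htb.le, ht.2⟩, ← hxy,
      h.eq_integral b ⟨h.lt.le, le_rfl⟩]
    abel

end IsCurve

/-! ### Changes of time with prescribed density -/

/-- A time change `τ : [-T,T] → [a,b]` whose inverse has the given almost everywhere positive
density `g`. -/
theorem exists_time_change {a b : ℝ} (hab : a < b) {g : ℝ → ℝ}
    (hg : IntervalIntegrable g volume a b) (hpos : ∀ᵐ t ∂volume.restrict (Icc a b), 0 < g t) :
    ∃ T > 0, ∃ τ : ℝ → ℝ, StrictMonoOn τ (Icc (-T) T) ∧ τ '' Icc (-T) T = Icc a b ∧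
      τ (-T) = a ∧ τ T = b ∧
      Measure.map τ (volume.restrict (Icc (-T) T)) =
        (volume.restrict (Icc a b)).withDensity (fun t => ENNReal.ofReal (g t)) := by
  have hgI : IntegrableOn g (Icc a b) := (intervalIntegrable_iff_integrableOn_Icc_of_le hab.le).1 hg
  have hsub : ∀ {s t : ℝ}, s ∈ Icc a b → t ∈ Icc a b → IntervalIntegrable g volume s t :=
    fun hs ht => hg.mono_set (by rw [uIcc_of_le hab.le]; exact uIcc_subset_Icc hs ht)
  have ha : a ∈ Icc a b := ⟨le_rfl, hab.le⟩
  have hb : b ∈ Icc a b := ⟨hab.le, le_rfl⟩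
  have hlt : ∀ {s t : ℝ}, s ∈ Icc a b → t ∈ Icc a b → s < t → 0 < ∫ r in s..t, g r := by
    intro s t hs ht hst
    have hss : Ioc s t ⊆ Icc a b := fun r hr => ⟨hs.1.trans hr.1.le, hr.2.trans ht.2⟩
    have hp : ∀ᵐ r ∂volume.restrict (Ioc s t), 0 < g r := ae_restrict_of_ae_restrict_of_subset hss hpos
    rw [intervalIntegral.integral_of_le hst.le]
    refine lt_of_le_of_ne (integral_nonneg_of_ae (hp.mono fun r hr => hr.le)) fun h0 => ?_
    have := (integral_eq_zero_iff_of_nonneg_ae (hp.mono fun r hr => hr.le)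
      (hgI.mono_set hss)).1 h0.symm
    have hF : ∀ᵐ r ∂volume.restrict (Ioc s t), False := by
      filter_upwards [hp, this] with r h1 h2
      exact h1.ne' h2
    rw [eventually_false_iff_eq_bot, ae_eq_bot, Measure.restrict_eq_zero, Real.volume_Ioc] at hF
    simp only [ENNReal.ofReal_eq_zero, sub_nonpos] at hF
    exact absurd hst (not_lt.2 hF)
  set L := ∫ r in a..b, g r with hL
  have hL0 : 0 < L := hlt ha hb hab
  -- New time as a function of the old one, centred so that its range is the symmetric interval
  -- `[-L/2, L/2]`; `τ` below is its inverse.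
  set S : ℝ → ℝ := fun t => (∫ r in a..t, g r) - L / 2 with hS
  have hSsub : ∀ {s t : ℝ}, s ∈ Icc a b → t ∈ Icc a b → S t - S s = ∫ r in s..t, g r := by
    intro s t hs ht
    simp only [hS]
    rw [← intervalIntegral.integral_add_adjacent_intervals (hsub ha hs) (hsub hs ht)]
    ring
  have hSm : StrictMonoOn S (Icc a b) := fun s hs t ht hst => by
    have := hlt hs ht hst
    rw [← hSsub hs ht] at this
    linarith
  have hSa : S a = -(L / 2) := by simp [hS]
  have hSb : S b = L / 2 := by simp only [hS]; rw [← hL]; ring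
  have hSc : ContinuousOn S (Icc a b) := by
    have := intervalIntegral.continuousOn_primitive_interval (μ := volume)
      (f := g) (a := a) (b := b) (intervalIntegrable_iff' (by simp) |>.1 hg)
    rw [uIcc_of_le hab.le] at this
    exact this.sub continuousOn_const
  have hsurj : Icc (-(L / 2)) (L / 2) ⊆ S '' Icc a b := by
    have := intermediate_value_Icc hab.le hSc
    rwa [hSa, hSb] at this
  have hSI : ∀ t ∈ Icc a b, S t ∈ Icc (-(L / 2)) (L / 2) := fun t ht => by
    rw [← hSa, ← hSb]
    exact ⟨hSm.monotoneOn ha ht ht.1, hSm.monotoneOn ht hb ht.2⟩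
  set τ := Function.invFunOn S (Icc a b) with hτ
  have hτI : ∀ s ∈ Icc (-(L / 2)) (L / 2), τ s ∈ Icc a b := fun s hs =>
    Function.invFunOn_mem (hsurj hs)
  have hSτ : ∀ s ∈ Icc (-(L / 2)) (L / 2), S (τ s) = s := fun s hs =>
    Function.invFunOn_eq (hsurj hs)
  have hτS : ∀ t ∈ Icc a b, τ (S t) = t := fun t ht =>
    hSm.injOn (hτI _ (hSI t ht)) ht (hSτ _ (hSI t ht))
  have hτm : StrictMonoOn τ (Icc (-(L / 2)) (L / 2)) := fun s hs t ht hst => by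
    rw [← hSm.lt_iff_lt (hτI s hs) (hτI t ht), hSτ s hs, hSτ t ht]
    exact hst
  have hmeas : AEMeasurable τ (volume.restrict (Icc (-(L / 2)) (L / 2))) :=
    aemeasurable_restrict_of_monotoneOn measurableSet_Icc hτm.monotoneOn
  refine ⟨L / 2, half_pos hL0, τ, hτm, ?_, ?_, ?_, ?_⟩
  · apply Subset.antisymm
    · rintro _ ⟨s, hs, rfl⟩
      exact hτI s hs
    · exact fun t ht => ⟨S t, hSI t ht, hτS t ht⟩
  · rw [← hSa, hτS a ha]
  · rw [← hSb, hτS b hb]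
  · have hIic : ∀ t ∈ Icc a b, ∫⁻ r in Icc a b ∩ Iic t, ENNReal.ofReal (g r) =
        ENNReal.ofReal (∫ r in a..t, g r) := by
      intro t ht
      have he : Icc a b ∩ Iic t = Icc a t := by
        ext r; simp only [mem_inter_iff, mem_Icc, mem_Iic]
        exact ⟨fun h => ⟨h.1.1, h.2⟩, fun h => ⟨⟨h.1, h.2.trans ht.2⟩, h.2⟩⟩
      have hss : Icc a t ⊆ Icc a b := Icc_subset_Icc_right ht.2
      rw [he, intervalIntegral.integral_of_le ht.1, ← integral_Icc_eq_integral_Ioc,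
        ofReal_integral_eq_lintegral_ofReal (hgI.mono_set hss)
          ((ae_restrict_of_ae_restrict_of_subset hss hpos).mono fun r hr => hr.le)]
    -- Two finite measures on the line agree once they agree on half-lines; only `t ∈ [a,b]` carries
    -- content, and there both masses are `S t + L/2`.
    refine Measure.ext_of_Iic _ _ fun t => ?_
    rw [Measure.map_apply_of_aemeasurable hmeas measurableSet_Iic,
      withDensity_apply _ measurableSet_Iic, Measure.restrict_restrict measurableSet_Iic,
      Measure.restrict_apply₀' measurableSet_Icc.nullMeasurableSet, inter_comm (Iic t)]
    rcases lt_or_ge t a with hta | hta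
    · have e1 : τ ⁻¹' Iic t ∩ Icc (-(L / 2)) (L / 2) = ∅ := by
        ext s
        simp only [mem_inter_iff, mem_preimage, mem_Iic, mem_empty_iff_false, iff_false, not_and]
        exact fun h1 h2 => absurd (hτI s h2).1 (by linarith)
      have e2 : Icc a b ∩ Iic t = ∅ := by
        ext s
        simp only [mem_inter_iff, mem_Icc, mem_Iic, mem_empty_iff_false, iff_false, not_and]
        exact fun h1 h2 => absurd h1.1 (by linarith)
      simp [e1, e2]
    · rcases le_or_gt t b with htb | htb
      · rw [hIic t ⟨hta, htb⟩]
        have e1 : τ ⁻¹' Iic t ∩ Icc (-(L / 2)) (L / 2) = Icc (-(L / 2)) (S t) := by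
          ext s
          simp only [mem_inter_iff, mem_preimage, mem_Iic, mem_Icc]
          constructor
          · rintro ⟨h1, h2⟩
            refine ⟨h2.1, ?_⟩
            rw [← hSτ s h2]
            exact hSm.monotoneOn (hτI s h2) ⟨hta, htb⟩ h1
          · rintro ⟨h1, h2⟩
            have h3 : s ∈ Icc (-(L / 2)) (L / 2) := ⟨h1, h2.trans (hSI t ⟨hta, htb⟩).2⟩
            refine ⟨?_, h3⟩
            rw [← hτS t ⟨hta, htb⟩]
            exact hτm.monotoneOn h3 (hSI t ⟨hta, htb⟩) h2
        rw [e1, Real.volume_Icc]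
        congr 1
        simp [hS]
      · have e1 : τ ⁻¹' Iic t ∩ Icc (-(L / 2)) (L / 2) = Icc (-(L / 2)) (L / 2) := by
          ext s
          simp only [mem_inter_iff, mem_preimage, mem_Iic, and_iff_right_iff_imp]
          exact fun h => (hτI s h).2.trans htb.le
        have e2 : Icc a b ∩ Iic t = Icc a b ∩ Iic b := by
          ext s
          simp only [mem_inter_iff, mem_Icc, mem_Iic]
          exact ⟨fun h => ⟨h.1, h.1.2⟩, fun h => ⟨h.1, h.1.2.trans htb.le⟩⟩
        rw [e1, e2, hIic b hb, Real.volume_Icc]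
        congr 1
        ring

/-! ### The conformal factor of the Jacobi metric -/

open Classical in
/-- The `0`-homogeneous extension of `√(2V)`, with value `0` at the origin. -/
def angular {n : ℕ} (V : Sph n → ℝ) (x : Space n) : ℝ :=
  if hx : x = 0 then 0 else √(2 * V (direction x hx))

/-- The conformal factor `√(2 V(x/|x|)) |x|^(β-1)` of the Jacobi metric for the exponent
`α = 2 - 2β`. -/
def jacobi {n : ℕ} (V : Sph n → ℝ) (β : ℝ) (x : Space n) : ℝ :=
  angular V x * ‖x‖ ^ (β - 1)

section angular

variable {n : ℕ} {V : Sph n → ℝ} {Vmin : ℝ}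

theorem angular_of_ne {x : Space n} (hx : x ≠ 0) :
    angular V x = √(2 * V (direction x hx)) := by simp [angular, hx]

theorem angular_nonneg (x : Space n) : 0 ≤ angular V x := by
  unfold angular; split_ifs
  · exact le_rfl
  · exact Real.sqrt_nonneg _

theorem jacobi_nonneg (β : ℝ) (x : Space n) : 0 ≤ jacobi V β x :=
  mul_nonneg (angular_nonneg x) (by positivity)

theorem angular_smul {k : ℝ} (hk : 0 < k) (x : Space n) : angular V (k • x) = angular V x := by
  by_cases hx : x = 0
  · simp [hx]
  · have hkx : k • x ≠ 0 := smul_ne_zero hk.ne' hx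
    rw [angular_of_ne hx, angular_of_ne hkx]
    have : direction (k • x) hkx = direction x hx := by
      apply Subtype.ext
      simp only [direction, norm_smul, Real.norm_eq_abs, abs_of_pos hk, smul_smul]
      congr 1
      field_simp
    rw [this]

theorem angular_coe (s : Sph n) : angular V s = √(2 * V s) := by
  have hs : ‖(s : Space n)‖ = 1 := by simp
  have h0 : (s : Space n) ≠ 0 := by
    intro h; rw [h, norm_zero] at hs; exact zero_ne_one hs
  rw [angular_of_ne h0]
  have : direction (s : Space n) h0 = s := by
    apply Subtype.ext
    simp [direction]
  rw [this]

theorem angular_continuousOn (hV : Continuous V) : ContinuousOn (angular V) {0}ᶜ := by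
  rw [continuousOn_iff_continuous_domRestrict]
  have : ({0}ᶜ : Set (Space n)).domRestrict (angular V) =
      fun x : ({0}ᶜ : Set (Space n)) => √(2 * V (direction x.1 x.2)) := by
    ext x
    exact angular_of_ne x.2
  rw [this]
  refine Real.continuous_sqrt.comp (continuous_const.mul (hV.comp ?_))
  refine Continuous.subtype_mk ?_ _
  exact (continuous_subtype_val.norm.inv₀ fun x => norm_ne_zero_iff.2 x.2).smul
    continuous_subtype_val

theorem jacobi_continuousOn (hV : Continuous V) (β : ℝ) : ContinuousOn (jacobi V β) {0}ᶜ :=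
  (angular_continuousOn hV).mul (continuous_norm.continuousOn.rpow_const fun _ hx =>
    Or.inl (norm_ne_zero_iff.2 hx))

theorem jacobi_measurable (hV : Continuous V) (β : ℝ) : Measurable (jacobi V β) :=
  measurable_of_continuousOn_compl_singleton 0 (jacobi_continuousOn hV β)

theorem le_angular (hmin : ∀ s, Vmin ≤ V s) {x : Space n} (hx : x ≠ 0) :
    √(2 * Vmin) ≤ angular V x := by
  rw [angular_of_ne hx]
  exact Real.sqrt_le_sqrt (by linarith [hmin (direction x hx)])

theorem jacobi_pos (h0 : 0 < Vmin) (hmin : ∀ s, Vmin ≤ V s) (β : ℝ) {x : Space n} (hx : x ≠ 0) :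
    0 < jacobi V β x := by
  have := norm_pos_iff.2 hx
  exact mul_pos ((by positivity : 0 < √(2 * Vmin)).trans_le (le_angular hmin hx)) (by positivity)

theorem le_jacobi (hmin : ∀ s, Vmin ≤ V s) (β : ℝ) {x : Space n} (hx : x ≠ 0) :
    √(2 * Vmin) * ‖x‖ ^ (β - 1) ≤ jacobi V β x :=
  mul_le_mul_of_nonneg_right (le_angular hmin hx) (by positivity)

/-- With `α = 2 - 2β` the weight `|x|^(-α)` is the square of `|x|^(β-1)`, so kinetic plus potential
energy is half a sum of two squares. -/
theorem potential_eq (h0 : 0 < Vmin) (hmin : ∀ s, Vmin ≤ V s) (β : ℝ) {x : Space n} (hx : x ≠ 0) :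
    potential V (2 - 2 * β) x = ENNReal.ofReal (jacobi V β x ^ 2 / 2) := by
  have hn := norm_pos_iff.2 hx
  rw [potential, dif_neg hx, jacobi, angular_of_ne hx, mul_pow, Real.sq_sqrt
    (by linarith [hmin (direction x hx)])]
  congr 1
  have : (‖x‖ ^ (β - 1)) ^ 2 = (‖x‖ ^ (2 - 2 * β))⁻¹ := by
    rw [← Real.rpow_natCast, ← Real.rpow_mul hn.le, ← Real.rpow_neg hn.le]
    congr 1; push_cast; ring
  rw [this, div_eq_mul_inv]; ring

theorem potential_measurable (h0 : 0 < Vmin) (hmin : ∀ s, Vmin ≤ V s) (hV : Continuous V) (β : ℝ) :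
    Measurable (potential V (2 - 2 * β)) := by
  classical
  have : potential V (2 - 2 * β) =
      fun x => if x ∈ ({0} : Set (Space n)) then ⊤ else ENNReal.ofReal (jacobi V β x ^ 2 / 2) := by
    ext x
    split_ifs with h
    · simp only [mem_singleton_iff] at h
      simp [potential, h]
    · exact potential_eq h0 hmin β h
  rw [this]
  exact Measurable.ite (measurableSet_singleton 0) measurable_const
    ((((jacobi_measurable hV β).pow_const 2).div_const 2).ennreal_ofReal)

/-- The action controls the Jacobi length. -/
theorem ofReal_jacobi_le (h0 : 0 < Vmin) (hmin : ∀ s, Vmin ≤ V s) (β : ℝ) (x v : Space n) :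
    ENNReal.ofReal (jacobi V β x * ‖v‖) ≤
      ENNReal.ofReal (‖v‖ ^ 2 / 2) + potential V (2 - 2 * β) x := by
  by_cases hx : x = 0
  · simp [potential, hx]
  · rw [potential_eq h0 hmin β hx, ← ENNReal.ofReal_add (by positivity) (by positivity)]
    refine ENNReal.ofReal_le_ofReal ?_
    nlinarith [sq_nonneg (jacobi V β x - ‖v‖)]

end angular

/-! ### Reparametrisation: action close to Jacobi length -/

section reparam

variable {n : ℕ} {V : Sph n → ℝ} {Vmin : ℝ} {a b : ℝ} {x v : ℝ → Space n}

/-- Reparametrisation of a curve by an absolutely continuous change of time. -/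
theorem IsCurve.exists_reparam (h : IsCurve a b x v) (h0 : 0 < Vmin) (hmin : ∀ s, Vmin ≤ V s)
    (hV : Continuous V) (β : ℝ) {g : ℝ → ℝ} (hg : IntervalIntegrable g volume a b)
    (hpos : ∀ᵐ t ∂volume.restrict (Icc a b), 0 < g t)
    (hfin : ∫⁻ t in Icc a b, (ENNReal.ofReal (g t) *
      (ENNReal.ofReal (‖(g t)⁻¹ • v t‖ ^ 2 / 2) + potential V (2 - 2 * β) (x t))) ≠ ⊤) :
    ∃ T > 0, ∃ y w : ℝ → Space n, IsH1Path (-T) T y w ∧ y (-T) = x a ∧ y T = x b ∧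
      (fun t => ‖y t‖) '' Icc (-T) T = (fun t => ‖x t‖) '' Icc a b ∧
      action V (2 - 2 * β) (-T) T y w = ∫⁻ t in Icc a b, (ENNReal.ofReal (g t) *
        (ENNReal.ofReal (‖(g t)⁻¹ • v t‖ ^ 2 / 2) + potential V (2 - 2 * β) (x t))) := by
  obtain ⟨T, hT, τ, hmono, himg, hτa, hτb, hmap⟩ := exists_time_change h.lt hg hpos
  have hgI : IntegrableOn g (Icc a b) :=
    (intervalIntegrable_iff_integrableOn_Icc_of_le h.lt.le).1 hg
  have hvI : IntegrableOn v (Icc a b) :=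
    (intervalIntegrable_iff_integrableOn_Icc_of_le h.lt.le).1 h.integrable
  have hτm : AEMeasurable τ (volume.restrict (Icc (-T) T)) :=
    aemeasurable_restrict_of_monotoneOn measurableSet_Icc hmono.monotoneOn
  set μ := (volume.restrict (Icc a b)).withDensity (fun t => ENNReal.ofReal (g t)) with hμ
  have hac : μ ≪ volume.restrict (Icc a b) := withDensity_absolutelyContinuous _ _
  have hgm : AEMeasurable (fun t => ENNReal.ofReal (g t)) (volume.restrict (Icc a b)) :=
    hgI.aestronglyMeasurable.aemeasurable.ennreal_ofReal
  have hzm : AEStronglyMeasurable (fun t => (g t)⁻¹ • v t) (volume.restrict (Icc a b)) :=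
    hgI.aestronglyMeasurable.inv₀.smul hvI.aestronglyMeasurable
  have hxm : AEMeasurable x (volume.restrict (Icc a b)) :=
    h.continuousOn.aemeasurable measurableSet_Icc
  have hFm : AEMeasurable (fun t => ENNReal.ofReal (‖(g t)⁻¹ • v t‖ ^ 2 / 2) +
      potential V (2 - 2 * β) (x t)) (volume.restrict (Icc a b)) :=
    ((hzm.norm.aemeasurable.pow_const 2).div_const 2).ennreal_ofReal.add
      ((potential_measurable h0 hmin hV β).comp_aemeasurable hxm)
  have hact : action V (2 - 2 * β) (-T) T (fun s => x (τ s)) (fun s => (g (τ s))⁻¹ • v (τ s)) =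
      ∫⁻ t in Icc a b, (ENNReal.ofReal (g t) *
        (ENNReal.ofReal (‖(g t)⁻¹ • v t‖ ^ 2 / 2) + potential V (2 - 2 * β) (x t))) := by
    unfold action
    rw [← lintegral_map' (f := fun t => ENNReal.ofReal (‖(g t)⁻¹ • v t‖ ^ 2 / 2) +
      potential V (2 - 2 * β) (x t)) (by rw [hmap]; exact hFm.mono_ac hac) hτm, hmap, hμ,
      lintegral_withDensity_eq_lintegral_mul₀ hgm hFm]
    rfl
  refine ⟨T, hT, fun s => x (τ s), fun s => (g (τ s))⁻¹ • v (τ s), ⟨?_, ?_⟩, ?_, ?_, ?_, hact⟩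
  · have hwm : AEStronglyMeasurable (fun s => (g (τ s))⁻¹ • v (τ s))
        (volume.restrict (Icc (-T) T)) := by
      refine AEStronglyMeasurable.comp_aemeasurable (g := fun t => (g t)⁻¹ • v t) ?_ hτm
      rw [hmap]
      exact hzm.mono_ac hac
    rw [memLp_two_iff_integrable_sq_norm hwm]
    refine ⟨(hwm.norm.pow 2), ?_⟩
    rw [hasFiniteIntegral_iff_ofReal (ae_of_all _ fun s => by positivity)]
    -- The kinetic part of the finite action already bounds half the squared `L²` norm of the new
    -- velocity.
    refine lt_of_le_of_lt (b := 2 * action V (2 - 2 * β) (-T) T (fun s => x (τ s))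
      (fun s => (g (τ s))⁻¹ • v (τ s))) ?_ ?_
    · unfold action
      rw [← lintegral_const_mul' _ _ (by simp)]
      refine lintegral_mono fun s => ?_
      rw [mul_add]
      refine le_add_right ?_
      have h2 : ∀ r : ℝ, ENNReal.ofReal (r ^ 2) ≤ 2 * ENNReal.ofReal (r ^ 2 / 2) := fun r => by
        rw [← ENNReal.ofReal_ofNat 2, ← ENNReal.ofReal_mul (by norm_num)]
        exact ENNReal.ofReal_le_ofReal (by linarith)
      exact h2 _
    · rw [hact]
      exact ENNReal.mul_lt_top (by simp) hfin.lt_top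
  · intro s hs
    have hτs : τ s ∈ Icc a b := himg ▸ mem_image_of_mem τ hs
    rw [hτa, h.eq_integral _ hτs]
    congr 1
    rw [intervalIntegral.integral_of_le hs.1, intervalIntegral.integral_of_le hτs.1,
      ← integral_Icc_eq_integral_Ioc, ← integral_Icc_eq_integral_Ioc]
    -- Monotonicity of `τ` turns the cut-off `r ≤ s` into `τ r ≤ τ s`, so the integrand becomes a
    -- function of `τ r` and can be pushed forward.
    have e1 : ∫ r in Icc (-T) s, (g (τ r))⁻¹ • v (τ r) =
        ∫ r in Icc (-T) T, (Iic (τ s)).indicator (fun t => (g t)⁻¹ • v t) (τ r) := by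
      have hss : Icc (-T) s ⊆ Icc (-T) T := Icc_subset_Icc_right hs.2
      rw [← inter_eq_self_of_subset_right hss, ← setIntegral_indicator measurableSet_Icc]
      refine setIntegral_congr_fun measurableSet_Icc fun r hr => ?_
      by_cases hrs : r ≤ s
      · rw [indicator_of_mem (show r ∈ Icc (-T) s from ⟨hr.1, hrs⟩),
          indicator_of_mem (show τ r ∈ Iic (τ s) from hmono.monotoneOn hr hs hrs)]
      · rw [indicator_of_notMem (show r ∉ Icc (-T) s from fun h => hrs h.2),
          indicator_of_notMem
            (show τ r ∉ Iic (τ s) from not_le.2 (hmono hs hr (not_le.1 hrs)))]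
    have hi : AEStronglyMeasurable ((Iic (τ s)).indicator (fun t => (g t)⁻¹ • v t)) μ :=
      (hzm.mono_ac hac).indicator measurableSet_Iic
    rw [e1, ← integral_map hτm (f := (Iic (τ s)).indicator (fun t => (g t)⁻¹ • v t))
      (by rw [hmap]; exact hi), hmap, hμ,
      integral_withDensity_eq_integral_toReal_smul₀ hgm (ae_of_all _ fun _ => by simp)]
    have e2 : ∫ r in Icc a (τ s), v r = ∫ r in Icc a b, (Icc a (τ s)).indicator v r := by
      have hss : Icc a (τ s) ⊆ Icc a b := Icc_subset_Icc_right hτs.2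
      rw [setIntegral_indicator measurableSet_Icc, inter_eq_self_of_subset_right hss]
    rw [e2]
    refine integral_congr_ae ?_
    filter_upwards [hpos, ae_restrict_mem measurableSet_Icc] with r hr hrI
    by_cases hrs : r ≤ τ s
    · rw [indicator_of_mem (show r ∈ Iic (τ s) from hrs),
        indicator_of_mem (show r ∈ Icc a (τ s) from ⟨hrI.1, hrs⟩), ENNReal.toReal_ofReal hr.le,
        smul_smul, mul_inv_cancel₀ hr.ne', one_smul]
    · rw [indicator_of_notMem (show r ∉ Iic (τ s) from hrs),
        indicator_of_notMem (show r ∉ Icc a (τ s) from fun h => hrs h.2), smul_zero]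
  · simp [hτa]
  · simp [hτb]
  · rw [← himg, image_image]

/-- A curve can be parametrised so that its action exceeds its Jacobi length by as little as
desired. -/
theorem IsCurve.exists_action_le (h : IsCurve a b x v) (h0 : 0 < Vmin) (hmin : ∀ s, Vmin ≤ V s)
    (hV : Continuous V) {β : ℝ} (hβ : β ≤ 1) (hne : ∀ᵐ t ∂volume.restrict (Icc a b), x t ≠ 0)
    (hw : IntervalIntegrable (fun t => jacobi V β (x t)) volume a b)
    (hJ : IntervalIntegrable (fun t => jacobi V β (x t) * ‖v t‖) volume a b)
    {η : ℝ} (hη : 0 < η) :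
    ∃ T > 0, ∃ y w : ℝ → Space n, IsH1Path (-T) T y w ∧ y (-T) = x a ∧ y T = x b ∧
      (fun t => ‖y t‖) '' Icc (-T) T = (fun t => ‖x t‖) '' Icc a b ∧
      action V (2 - 2 * β) (-T) T y w ≤ ENNReal.ofReal
        ((∫ t in a..b, jacobi V β (x t) * ‖v t‖) + η * ∫ t in a..b, jacobi V β (x t)) := by
  have hIcc : ∀ {f : ℝ → ℝ}, IntervalIntegrable f volume a b ↔ IntegrableOn f (Icc a b) :=
    intervalIntegrable_iff_integrableOn_Icc_of_le h.lt.le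
  have hvI : IntegrableOn v (Icc a b) :=
    (intervalIntegrable_iff_integrableOn_Icc_of_le h.lt.le).1 h.integrable
  have hxm : AEMeasurable x (volume.restrict (Icc a b)) :=
    h.continuousOn.aemeasurable measurableSet_Icc
  -- Equality of action and length would need the density `|v|/J`; replacing `|v|` by `√(|v|² + η²)`
  -- keeps it positive where `v` vanishes.
  set g : ℝ → ℝ := fun t => √(‖v t‖ ^ 2 + η ^ 2) / jacobi V β (x t) with hgdef
  have hsq : ∀ t, √(‖v t‖ ^ 2 + η ^ 2) ≤ ‖v t‖ + η := fun t =>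
    Real.sqrt_le_iff.2 ⟨by positivity, by nlinarith [norm_nonneg (v t)]⟩
  have hpos : ∀ᵐ t ∂volume.restrict (Icc a b), 0 < g t := by
    filter_upwards [hne] with t ht
    have := jacobi_pos h0 hmin β ht
    positivity
  obtain ⟨C, hC⟩ := isCompact_Icc.exists_bound_of_continuousOn h.continuousOn
  have hc : 0 < √(2 * Vmin) := by positivity
  have hg : IntervalIntegrable g volume a b := by
    rw [hIcc]
    -- Since `β ≤ 1` and the curve stays in a ball of radius `C`, `J ≥ √(2Vmin) C^(β-1)`, so `1/J`
    -- is bounded.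
    refine Integrable.mono' (((hvI.norm.add (integrable_const η)).const_mul
      (C ^ (1 - β) / √(2 * Vmin)))) ?_ ?_
    · refine AEMeasurable.aestronglyMeasurable ?_
      exact (((hvI.aestronglyMeasurable.norm.aemeasurable.pow_const 2).add_const _).sqrt).div
        ((jacobi_measurable hV β).comp_aemeasurable hxm)
    · filter_upwards [hne, ae_restrict_mem measurableSet_Icc] with t ht htI
      have hj := jacobi_pos h0 hmin β ht
      have hn := norm_pos_iff.2 ht
      have hCp : 0 < C := hn.trans_le (hC t htI)
      rw [hgdef, Real.norm_of_nonneg (by positivity), div_le_iff₀ hj]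
      have h1 : 1 ≤ C ^ (1 - β) / √(2 * Vmin) * jacobi V β (x t) := by
        have h2 : C ^ (β - 1) ≤ ‖x t‖ ^ (β - 1) :=
          Real.rpow_le_rpow_of_nonpos hn (hC t htI) (by linarith)
        calc (1:ℝ) = C ^ (1 - β) / √(2 * Vmin) * (√(2 * Vmin) * C ^ (β - 1)) := by
              have : C ^ (1 - β) * C ^ (β - 1) = 1 := by
                rw [← Real.rpow_add hCp]; simp
              field_simp
              linarith
          _ ≤ _ := by
              refine mul_le_mul_of_nonneg_left ?_ (by positivity)
              exact (mul_le_mul_of_nonneg_left h2 hc.le).trans (le_jacobi hmin β ht)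
      calc √(‖v t‖ ^ 2 + η ^ 2) ≤ ‖v t‖ + η := hsq t
        _ ≤ (‖v t‖ + η) * (C ^ (1 - β) / √(2 * Vmin) * jacobi V β (x t)) :=
            le_mul_of_one_le_right (by positivity) h1
        _ = _ := by simp only [Pi.add_apply]; ring
  have hle : ∫⁻ t in Icc a b, (ENNReal.ofReal (g t) *
      (ENNReal.ofReal (‖(g t)⁻¹ • v t‖ ^ 2 / 2) + potential V (2 - 2 * β) (x t))) ≤
      ENNReal.ofReal
        ((∫ t in a..b, jacobi V β (x t) * ‖v t‖) + η * ∫ t in a..b, jacobi V β (x t)) := by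
    rw [← intervalIntegral.integral_const_mul, ← intervalIntegral.integral_add hJ (hw.const_mul η),
      intervalIntegral.integral_of_le h.lt.le, ← integral_Icc_eq_integral_Ioc,
      ofReal_integral_eq_lintegral_ofReal
        (f := fun t => jacobi V β (x t) * ‖v t‖ + η * jacobi V β (x t))
        ((hIcc.1 hJ).add ((hIcc.1 hw).const_mul η))
        (ae_of_all _ fun t => add_nonneg (mul_nonneg (jacobi_nonneg _ _) (norm_nonneg _))
          (mul_nonneg hη.le (jacobi_nonneg _ _)))]
    refine lintegral_mono_ae ?_
    filter_upwards [hne, hpos] with t ht hgt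
    have hj := jacobi_pos h0 hmin β ht
    rw [potential_eq h0 hmin β ht, ← ENNReal.ofReal_add (by positivity) (by positivity),
      ← ENNReal.ofReal_mul hgt.le]
    refine ENNReal.ofReal_le_ofReal ?_
    rw [norm_smul, Real.norm_of_nonneg (inv_nonneg.2 hgt.le)]
    set q := √(‖v t‖ ^ 2 + η ^ 2) with hq
    have hq0 : 0 < q := by positivity
    have hq2 : q ^ 2 = ‖v t‖ ^ 2 + η ^ 2 := Real.sq_sqrt (by positivity)
    have hgq : g t = q / jacobi V β (x t) := rfl
    rw [hgq]
    set j := jacobi V β (x t)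
    -- Since `|v| ≤ q`, this density is at most `j q`, hence at most `j (|v| + η)`.
    have e : q / j * (((q / j)⁻¹ * ‖v t‖) ^ 2 / 2 + j ^ 2 / 2) = j * (‖v t‖ ^ 2 + q ^ 2) / (2 * q) := by
      field_simp
    rw [e, div_le_iff₀ (by positivity)]
    have : ‖v t‖ ^ 2 + q ^ 2 ≤ 2 * q * q := by nlinarith
    calc j * (‖v t‖ ^ 2 + q ^ 2) ≤ j * (2 * q * q) := mul_le_mul_of_nonneg_left this hj.le
      _ ≤ j * (2 * q * (‖v t‖ + η)) := by
          refine mul_le_mul_of_nonneg_left (mul_le_mul_of_nonneg_left (hsq t) (by positivity)) hj.le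
      _ = _ := by ring
  obtain ⟨T, hT, y, w, h1, h2, h3, h4, h5⟩ := h.exists_reparam h0 hmin hV β hg hpos
    (ne_top_of_le_ne_top ENNReal.ofReal_ne_top hle)
  exact ⟨T, hT, y, w, h1, h2, h3, h4, h5.trans_le hle⟩

end reparam

/-! ### Radial derivative and the power map -/

section radial

variable {E : Type*} [NormedAddCommGroup E] [InnerProductSpace ℝ E]

/-- The derivative of `|x|` in the direction `v`. -/
def radialDeriv (x v : E) : ℝ := inner ℝ x v / ‖x‖

theorem abs_radialDeriv_le (x v : E) : |radialDeriv x v| ≤ ‖v‖ := by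
  rw [radialDeriv, abs_div, abs_of_nonneg (norm_nonneg x)]
  refine div_le_of_le_mul₀ (norm_nonneg x) (norm_nonneg v) ?_
  rw [mul_comm]
  exact abs_real_inner_le_norm x v

theorem hasFDerivAt_sq_norm_add_rpow (δ q : ℝ) {x : E} (h : ‖x‖ ^ 2 + δ ≠ 0) :
    HasFDerivAt (fun z : E => (‖z‖ ^ 2 + δ) ^ q)
      ((2 * q * (‖x‖ ^ 2 + δ) ^ (q - 1)) • innerSL ℝ x) x := by
  have h1 := (((hasStrictFDerivAt_norm_sq x).hasFDerivAt).add_const δ).rpow_const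
    (p := q) (Or.inl h)
  refine h1.congr_fderiv ?_
  ext z
  simp only [smul_apply, smul_eq_mul, nsmul_eq_mul]
  push_cast
  ring

theorem hasFDerivAt_norm_rpow_of_ne (p : ℝ) {x : E} (h : x ≠ 0) :
    HasFDerivAt (fun z : E => ‖z‖ ^ p) ((p * ‖x‖ ^ (p - 2)) • innerSL ℝ x) x := by
  have hx := norm_pos_iff.2 h
  have h1 := hasFDerivAt_sq_norm_add_rpow 0 (p / 2) (x := x) (by positivity)
  have e : ∀ (z : E) (q : ℝ), (‖z‖ ^ 2 + 0) ^ q = ‖z‖ ^ (2 * q) := fun z q => by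
    rw [add_zero, ← Real.rpow_natCast, ← Real.rpow_mul (norm_nonneg z)]
    norm_num
  simp only [e] at h1
  convert h1 using 3
  · ring_nf
  · ring
  · ring_nf

/-- The power map `x ↦ |x|^(p-1) x`. -/
def powerMap (p : ℝ) (x : E) : E := ‖x‖ ^ (p - 1) • x

/-- The derivative of the power map. -/
def powerMapDeriv (p : ℝ) (x : E) : E →L[ℝ] E :=
  ‖x‖ ^ (p - 1) • ContinuousLinearMap.id ℝ E +
    (((p - 1) * ‖x‖ ^ (p - 1 - 2)) • innerSL ℝ x).smulRight x

theorem hasFDerivAt_powerMap (p : ℝ) {x : E} (h : x ≠ 0) :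
    HasFDerivAt (powerMap p) (powerMapDeriv p x) x :=
  (hasFDerivAt_norm_rpow_of_ne (p - 1) h).smul (hasFDerivAt_id x)

theorem norm_powerMap (p : ℝ) {x : E} (h : x ≠ 0) : ‖powerMap p x‖ = ‖x‖ ^ p := by
  have hx := norm_pos_iff.2 h
  rw [powerMap, norm_smul, Real.norm_of_nonneg (by positivity)]
  nth_rewrite 2 [← Real.rpow_one ‖x‖]
  rw [← Real.rpow_add hx]
  congr 1; ring

/-- The differential scales the component of `v` orthogonal to `x` by `|x|^(p-1)` and the radial one
by `p |x|^(p-1)`. -/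
theorem norm_powerMapDeriv_sq (p : ℝ) {x : E} (h : x ≠ 0) (v : E) :
    ‖powerMapDeriv p x v‖ ^ 2 =
      (‖x‖ ^ (p - 1)) ^ 2 * (‖v‖ ^ 2 - (1 - p ^ 2) * radialDeriv x v ^ 2) := by
  have hx := norm_pos_iff.2 h
  have e : ‖x‖ ^ (p - 1 - 2) = ‖x‖ ^ (p - 1) / ‖x‖ ^ 2 := by
    rw [Real.rpow_sub hx]; norm_num
  have e2 : powerMapDeriv p x v =
      ‖x‖ ^ (p - 1) • (v + ((p - 1) * inner ℝ x v / ‖x‖ ^ 2) • x) := by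
    simp only [powerMapDeriv, add_apply, smul_apply,
      ContinuousLinearMap.id_apply, ContinuousLinearMap.smulRight_apply, innerSL_apply_apply, e,
      smul_eq_mul, smul_add, smul_smul]
    congr 2
    ring
  rw [e2, norm_smul, mul_pow, Real.norm_of_nonneg (by positivity), norm_add_sq_real, norm_smul,
    inner_smul_right, real_inner_comm x v, mul_pow, Real.norm_eq_abs, sq_abs, radialDeriv]
  congr 1
  field_simp
  ring

/-- The power map with exponent `p ≤ 1` shortens velocities. -/
theorem mul_norm_powerMapDeriv_le {p : ℝ} (hp : 0 < p) (hp1 : p ≤ 1) {x : E} (h : x ≠ 0) (v : E) :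
    p * ‖powerMapDeriv p x v‖ ≤
      ‖x‖ ^ (p - 1) * (‖v‖ - (1 - p ^ 2) * |radialDeriv x v|) := by
  have hx := norm_pos_iff.2 h
  have hr := abs_radialDeriv_le x v
  have hr0 := abs_nonneg (radialDeriv x v)
  have hp2 : 0 ≤ 1 - p ^ 2 := by nlinarith
  have h0 : 0 ≤ ‖v‖ - (1 - p ^ 2) * |radialDeriv x v| := by nlinarith [sq_nonneg p]
  refine abs_le_of_sq_le_sq' ?_ (by positivity) |>.2
  rw [mul_pow, norm_powerMapDeriv_sq p h, mul_pow, ← sq_abs (radialDeriv x v)]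
  -- The right side minus the left side is exactly `(1 - p²)(‖v‖ - |radialDeriv|)²`.
  have : p ^ 2 * (‖v‖ ^ 2 - (1 - p ^ 2) * |radialDeriv x v| ^ 2) ≤
      (‖v‖ - (1 - p ^ 2) * |radialDeriv x v|) ^ 2 := by
    nlinarith [mul_nonneg hp2 (sq_nonneg (‖v‖ - |radialDeriv x v|))]
  calc _ = (‖x‖ ^ (p - 1)) ^ 2 * (p ^ 2 * (‖v‖ ^ 2 - (1 - p ^ 2) * |radialDeriv x v| ^ 2)) := by ring
    _ ≤ _ := mul_le_mul_of_nonneg_left this (by positivity)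

variable [CompleteSpace E] {a b : ℝ} {x v : ℝ → E}

/-- A smooth substitute for `|x|^(2q)` that survives passage through the origin; it serves for
collision paths, letting `δ → 0`. -/
theorem IsCurve.sq_norm_add_rpow (h : IsCurve a b x v) {δ : ℝ} (hδ : 0 < δ) (q : ℝ) :
    IsCurve a b (fun t => (‖x t‖ ^ 2 + δ) ^ q)
      (fun t => 2 * q * (‖x t‖ ^ 2 + δ) ^ (q - 1) * inner ℝ (x t) (v t)) := by
  have := h.comp (f := fun z : E => (‖z‖ ^ 2 + δ) ^ q)
    (f' := fun z => (2 * q * (‖z‖ ^ 2 + δ) ^ (q - 1)) • innerSL ℝ z)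
    (fun t _ => hasFDerivAt_sq_norm_add_rpow δ q (by positivity)) ?_
  · simpa using this
  · have hx := h.continuousOn
    have hi : ContinuousOn (fun t => innerSL ℝ (x t)) (Icc a b) :=
      (innerSL ℝ (E := E)).continuous.comp_continuousOn hx
    refine ContinuousOn.smul (f := fun t => 2 * q * (‖x t‖ ^ 2 + δ) ^ (q - 1)) ?_ hi
    exact continuousOn_const.mul (((hx.norm.pow 2).add continuousOn_const).rpow_const
      fun t _ => Or.inl (add_pos_of_nonneg_of_pos (sq_nonneg _) hδ).ne')

theorem IsCurve.norm_rpow (h : IsCurve a b x v) (hne : ∀ t ∈ Icc a b, x t ≠ 0) (β : ℝ) :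
    IsCurve a b (fun t => ‖x t‖ ^ β)
      (fun t => β * (‖x t‖ ^ (β - 1) * radialDeriv (x t) (v t))) := by
  have hx := h.continuousOn
  have h1 := h.comp (f := fun z : E => ‖z‖ ^ β) (f' := fun z => (β * ‖z‖ ^ (β - 2)) • innerSL ℝ z)
    (fun t ht => hasFDerivAt_norm_rpow_of_ne β (hne t ht)) (by
      have hi : ContinuousOn (fun t => innerSL ℝ (x t)) (Icc a b) :=
        (innerSL ℝ (E := E)).continuous.comp_continuousOn hx
      refine ContinuousOn.smul (f := fun t => β * ‖x t‖ ^ (β - 2)) ?_ hi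
      exact continuousOn_const.mul (hx.norm.rpow_const
        fun t ht => Or.inl (norm_ne_zero_iff.2 (hne t ht))))
  have e : ∀ t ∈ Icc a b, ((β * ‖x t‖ ^ (β - 2)) • innerSL ℝ (x t)) (v t) =
      β * (‖x t‖ ^ (β - 1) * radialDeriv (x t) (v t)) := fun t ht => by
    have hn := norm_pos_iff.2 (hne t ht)
    have : ‖x t‖ ^ (β - 1) = ‖x t‖ ^ (β - 2) * ‖x t‖ := by
      nth_rewrite 3 [← Real.rpow_one ‖x t‖]
      rw [← Real.rpow_add hn]
      congr 1; ring
    simp only [smul_apply, innerSL_apply_apply, smul_eq_mul, radialDeriv, this]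
    field_simp
  refine ⟨h.lt, h1.integrable.congr fun t ht => ?_, fun t ht => ?_⟩
  · rw [uIoc_of_le h.lt.le] at ht
    exact e t (Ioc_subset_Icc_self ht)
  · rw [h1.eq_integral t ht]
    congr 1
    refine intervalIntegral.integral_congr fun s hs => ?_
    rw [uIcc_of_le ht.1] at hs
    exact e s ⟨hs.1, hs.2.trans ht.2⟩

theorem IsCurve.intervalIntegrable_radial (h : IsCurve a b x v) (hne : ∀ t ∈ Icc a b, x t ≠ 0)
    {β : ℝ} (hβ : 0 < β) {s t : ℝ} (hs : s ∈ Icc a b) (ht : t ∈ Icc a b) :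
    IntervalIntegrable (fun t => ‖x t‖ ^ (β - 1) * radialDeriv (x t) (v t)) volume s t := by
  have := ((h.norm_rpow hne β).integrable_sub hs ht).const_mul β⁻¹
  simpa [hβ.ne'] using this

/-- The form `r^(β-1) dr` is exact, so the integral depends on the end radii alone. This is what
lets radial lengths be subtracted under the integral sign. -/
theorem IsCurve.integral_radial (h : IsCurve a b x v) (hne : ∀ t ∈ Icc a b, x t ≠ 0)
    {β : ℝ} (hβ : 0 < β) {s t : ℝ} (hs : s ∈ Icc a b) (ht : t ∈ Icc a b) :
    ∫ r in s..t, ‖x r‖ ^ (β - 1) * radialDeriv (x r) (v r) = (‖x t‖ ^ β - ‖x s‖ ^ β) / β := by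
  have := (h.norm_rpow hne β).sub_eq hs ht
  rw [this, intervalIntegral.integral_const_mul]
  field_simp

theorem IsCurve.powerMap (h : IsCurve a b x v) (hne : ∀ t ∈ Icc a b, x t ≠ 0) (p : ℝ) :
    IsCurve a b (fun t => powerMap p (x t)) (fun t => powerMapDeriv p (x t) (v t)) := by
  refine h.comp (fun t ht => hasFDerivAt_powerMap p (hne t ht)) ?_
  have hx := h.continuousOn
  have hn : ∀ q : ℝ, ContinuousOn (fun t => ‖x t‖ ^ q) (Icc a b) := fun q =>
    hx.norm.rpow_const fun t ht => Or.inl (norm_ne_zero_iff.2 (hne t ht))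
  refine ((hn _).smul continuousOn_const).add ?_
  exact ((ContinuousLinearMap.smulRightL ℝ E E).continuous₂.comp_continuousOn
    (((continuousOn_const.mul (hn _)).smul ((innerSL ℝ (E := E)).continuous.comp_continuousOn hx)).prodMk hx))

end radial

/-! ### Jacobi length: scaling, concatenation, rays -/

section length

variable {n : ℕ} {V : Sph n → ℝ} {Vmin : ℝ} {a b : ℝ} {x v : ℝ → Space n}

/-- The Jacobi length of a curve. -/
def jacobiLength (V : Sph n → ℝ) (β a b : ℝ) (x v : ℝ → Space n) : ℝ :=
  ∫ t in a..b, jacobi V β (x t) * ‖v t‖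

theorem IsCurve.jacobi_continuousOn (h : IsCurve a b x v) (hne : ∀ t ∈ Icc a b, x t ≠ 0)
    (hV : Continuous V) (β : ℝ) : ContinuousOn (fun t => jacobi V β (x t)) (Icc a b) :=
  (_root_.jacobi_continuousOn hV β).comp h.continuousOn hne

theorem IsCurve.intervalIntegrable_jacobi (h : IsCurve a b x v) (hne : ∀ t ∈ Icc a b, x t ≠ 0)
    (hV : Continuous V) (β : ℝ) {s t : ℝ} (hs : s ∈ Icc a b) (ht : t ∈ Icc a b) :
    IntervalIntegrable (fun t => jacobi V β (x t) * ‖v t‖) volume s t := by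
  have hc := h.jacobi_continuousOn hne hV β
  refine (h.integrable_sub hs ht).norm.continuousOn_mul (hc.mono (uIcc_subset_Icc hs ht))

/-- The conformal factor contributes degree `β - 1` and the speed degree `1`. -/
theorem jacobiLength_smul {k : ℝ} (hk : 0 < k) (V : Sph n → ℝ) (β a b : ℝ)
    (x v : ℝ → Space n) :
    jacobiLength V β a b (fun t => k • x t) (fun t => k • v t) = k ^ β * jacobiLength V β a b x v := by
  unfold jacobiLength
  rw [← intervalIntegral.integral_const_mul]
  congr 1
  ext t
  rw [jacobi, jacobi, angular_smul hk, norm_smul, norm_smul, Real.norm_of_nonneg hk.le,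
    Real.mul_rpow hk.le (norm_nonneg _), Real.rpow_sub_one hk.ne']
  field_simp

theorem IsCurve.smul (h : IsCurve a b x v) (k : ℝ) :
    IsCurve a b (fun t => k • x t) (fun t => k • v t) where
  lt := h.lt
  integrable := h.integrable.smul k
  eq_integral t ht := by
    rw [h.eq_integral t ht, smul_add, intervalIntegral.integral_smul]

theorem jacobiLength_concat {c : ℝ} {y w : ℝ → Space n} (h : IsCurve a b x v)
    (h' : IsCurve b c y w) (hx : ∀ t ∈ Icc a b, x t ≠ 0) (hy : ∀ t ∈ Icc b c, y t ≠ 0)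
    (hV : Continuous V) (β : ℝ) :
    jacobiLength V β a c (fun t => if t ≤ b then x t else y t)
      (fun t => if t ≤ b then v t else w t) = jacobiLength V β a b x v + jacobiLength V β b c y w := by
  have i1 := h.intervalIntegrable_jacobi hx hV β ⟨le_rfl, h.lt.le⟩ ⟨h.lt.le, le_rfl⟩
  have i2 := h'.intervalIntegrable_jacobi hy hV β ⟨le_rfl, h'.lt.le⟩ ⟨h'.lt.le, le_rfl⟩
  have e1 : ∀ t ∈ uIoc a b, jacobi V β (x t) * ‖v t‖ =
      jacobi V β (if t ≤ b then x t else y t) * ‖if t ≤ b then v t else w t‖ := fun t ht => by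
    rw [uIoc_of_le h.lt.le] at ht
    simp [ht.2]
  have e2 : ∀ t ∈ uIoc b c, jacobi V β (y t) * ‖w t‖ =
      jacobi V β (if t ≤ b then x t else y t) * ‖if t ≤ b then v t else w t‖ := fun t ht => by
    rw [uIoc_of_le h'.lt.le] at ht
    simp [not_le.2 ht.1]
  unfold jacobiLength
  rw [← intervalIntegral.integral_add_adjacent_intervals (i1.congr e1) (i2.congr e2),
    intervalIntegral.integral_congr_ae (ae_of_all _ e1),
    intervalIntegral.integral_congr_ae (ae_of_all _ e2)]

/-- A segment of a ray, with affine radius. -/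
theorem isCurve_ray (hab : a < b) (r₀ r₁ : ℝ) (e : Space n) :
    IsCurve a b (fun t => (r₀ + r₁ * t) • e) (fun _ => r₁ • e) where
  lt := hab
  integrable := intervalIntegrable_const
  eq_integral t ht := by
    rw [intervalIntegral.integral_const, smul_smul, ← add_smul]
    congr 1; ring

theorem jacobiLength_ray (hab : a < b) {r₀ r₁ : ℝ} (s : Sph n)
    (hpos : ∀ t ∈ Icc a b, 0 < r₀ + r₁ * t) {β : ℝ} (hβ : 0 < β) :
    jacobiLength V β a b (fun t => (r₀ + r₁ * t) • (s : Space n)) (fun _ => r₁ • (s : Space n)) =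
      √(2 * V s) * |(r₀ + r₁ * b) ^ β - (r₀ + r₁ * a) ^ β| / β := by
  have hs : ‖(s : Space n)‖ = 1 := by simp
  have hnr : ∀ t ∈ Icc a b, ‖(r₀ + r₁ * t) • (s : Space n)‖ = r₀ + r₁ * t := fun t ht => by
    rw [norm_smul, hs, mul_one, Real.norm_of_nonneg (hpos t ht).le]
  have hr := (isCurve_ray hab r₀ r₁ (s : Space n)).integral_radial (fun t ht => by
    rw [← norm_pos_iff, hnr t ht]; exact hpos t ht) hβ ⟨le_rfl, hab.le⟩ ⟨hab.le, le_rfl⟩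
  rw [hnr a ⟨le_rfl, hab.le⟩, hnr b ⟨hab.le, le_rfl⟩] at hr
  have hI : ∫ t in a..b, ‖(r₀ + r₁ * t) • (s : Space n)‖ ^ (β - 1) *
      radialDeriv ((r₀ + r₁ * t) • (s : Space n)) (r₁ • (s : Space n)) =
      r₁ * ∫ t in a..b, (r₀ + r₁ * t) ^ (β - 1) := by
    rw [← intervalIntegral.integral_const_mul]
    refine intervalIntegral.integral_congr fun t ht => ?_
    rw [uIcc_of_le hab.le] at ht
    have := hpos t ht
    simp only [hnr t ht, radialDeriv, inner_smul_left, inner_smul_right,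
      real_inner_self_eq_norm_sq, hs]
    simp
    field_simp
  rw [hI] at hr
  have hJ : jacobiLength V β a b (fun t => (r₀ + r₁ * t) • (s : Space n))
      (fun _ => r₁ • (s : Space n)) = √(2 * V s) * (|r₁| * ∫ t in a..b, (r₀ + r₁ * t) ^ (β - 1)) := by
    unfold jacobiLength
    rw [← intervalIntegral.integral_const_mul, ← intervalIntegral.integral_const_mul]
    refine intervalIntegral.integral_congr fun t ht => ?_
    rw [uIcc_of_le hab.le] at ht
    simp only [jacobi, angular_smul (hpos t ht), angular_coe, hnr t ht, norm_smul, hs,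
      Real.norm_eq_abs]
    ring
  have hI0 : 0 ≤ ∫ t in a..b, (r₀ + r₁ * t) ^ (β - 1) :=
    intervalIntegral.integral_nonneg hab.le fun t ht => (Real.rpow_pos_of_pos (hpos t ht) _).le
  rw [hJ, mul_div_assoc]
  congr 1
  rw [eq_div_iff hβ.ne'] at hr
  rw [← hr, abs_mul, abs_mul, abs_of_nonneg hI0, abs_of_pos hβ]
  field_simp

end length

/-! ### Competitors at distance one and their excess -/

/-- Curves from `R ξm` to `R ξp` whose minimal distance to the origin is `ρ`. -/
structure IsCompetitor {n : ℕ} (ξm ξp : Sph n) (R ρ a b : ℝ) (x v : ℝ → Space n) : Prop where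
  curve : IsCurve a b x v
  left : x a = R • (ξm : Space n)
  right : x b = R • (ξp : Space n)
  isLeast : IsLeast ((fun t => ‖x t‖) '' Icc a b) ρ

/-- The Jacobi length of a competitor at distance `1`, minus the length of the two radial
segments. -/
def excess {n : ℕ} (V : Sph n → ℝ) (Vmin β R a b : ℝ) (x v : ℝ → Space n) : ℝ :=
  jacobiLength V β a b x v - 2 * (√(2 * Vmin) * ((R ^ β - 1) / β))

namespace IsCompetitor

variable {n : ℕ} {ξm ξp : Sph n} {V : Sph n → ℝ} {Vmin R ρ a b : ℝ} {x v : ℝ → Space n}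

theorem le_norm (h : IsCompetitor ξm ξp R ρ a b x v) {t : ℝ} (ht : t ∈ Icc a b) : ρ ≤ ‖x t‖ :=
  h.isLeast.2 (mem_image_of_mem _ ht)

theorem ne_zero (h : IsCompetitor ξm ξp R ρ a b x v) (hρ : 0 < ρ) : ∀ t ∈ Icc a b, x t ≠ 0 :=
  fun _ ht => norm_pos_iff.1 (hρ.trans_le (h.le_norm ht))

theorem left_mem (h : IsCompetitor ξm ξp R ρ a b x v) : a ∈ Icc a b := ⟨le_rfl, h.curve.lt.le⟩

theorem right_mem (h : IsCompetitor ξm ξp R ρ a b x v) : b ∈ Icc a b := ⟨h.curve.lt.le, le_rfl⟩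

theorem norm_left (h : IsCompetitor ξm ξp R ρ a b x v) (hR : 0 ≤ R) : ‖x a‖ = R := by
  rw [h.left, norm_smul, Real.norm_of_nonneg hR]; simp

theorem norm_right (h : IsCompetitor ξm ξp R ρ a b x v) (hR : 0 ≤ R) : ‖x b‖ = R := by
  rw [h.right, norm_smul, Real.norm_of_nonneg hR]; simp

theorem smul (h : IsCompetitor ξm ξp R ρ a b x v) {k : ℝ} (hk : 0 < k) :
    IsCompetitor ξm ξp (k * R) (k * ρ) a b (fun t => k • x t) (fun t => k • v t) where
  curve := h.curve.smul k
  left := by rw [h.left, smul_smul]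
  right := by rw [h.right, smul_smul]
  isLeast := by
    obtain ⟨⟨t, ht, hxt⟩, h2⟩ := h.isLeast
    refine ⟨⟨t, ht, ?_⟩, ?_⟩
    · simp only at hxt ⊢
      rw [norm_smul, Real.norm_of_nonneg hk.le, hxt]
    · rintro _ ⟨s, hs, rfl⟩
      simp only [norm_smul, Real.norm_of_nonneg hk.le]
      exact mul_le_mul_of_nonneg_left (h.le_norm hs) hk.le

/-- The excess as the integral of a nonnegative density. -/
theorem exists_excess_eq (h : IsCompetitor ξm ξp R 1 a b x v) (hR : 0 ≤ R) (hV : Continuous V)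
    (Vmin : ℝ) : ∃ t₀ ∈ Icc a b, ‖x t₀‖ = 1 ∧ ∀ β, 0 < β → excess V Vmin β R a b x v =
      (∫ t in a..t₀, ‖x t‖ ^ (β - 1) *
        (angular V (x t) * ‖v t‖ + √(2 * Vmin) * radialDeriv (x t) (v t))) +
      ∫ t in t₀..b, ‖x t‖ ^ (β - 1) *
        (angular V (x t) * ‖v t‖ - √(2 * Vmin) * radialDeriv (x t) (v t)) := by
  obtain ⟨t₀, ht₀, hx₀⟩ := h.isLeast.1
  simp only at hx₀
  have hne := h.ne_zero one_pos
  refine ⟨t₀, ht₀, hx₀, fun β hβ => ?_⟩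
  have iJ := fun {s t : ℝ} (hs : s ∈ Icc a b) (ht : t ∈ Icc a b) =>
    h.curve.intervalIntegrable_jacobi hne hV β hs ht
  have iR := fun {s t : ℝ} (hs : s ∈ Icc a b) (ht : t ∈ Icc a b) =>
    h.curve.intervalIntegrable_radial hne hβ hs ht
  have e1 : ∀ t, ‖x t‖ ^ (β - 1) *
      (angular V (x t) * ‖v t‖ + √(2 * Vmin) * radialDeriv (x t) (v t)) =
      jacobi V β (x t) * ‖v t‖ + √(2 * Vmin) * (‖x t‖ ^ (β - 1) * radialDeriv (x t) (v t)) :=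
    fun t => by rw [jacobi]; ring
  have e2 : ∀ t, ‖x t‖ ^ (β - 1) *
      (angular V (x t) * ‖v t‖ - √(2 * Vmin) * radialDeriv (x t) (v t)) =
      jacobi V β (x t) * ‖v t‖ - √(2 * Vmin) * (‖x t‖ ^ (β - 1) * radialDeriv (x t) (v t)) :=
    fun t => by rw [jacobi]; ring
  simp only [e1, e2]
  rw [intervalIntegral.integral_add (iJ h.left_mem ht₀) ((iR h.left_mem ht₀).const_mul _),
    intervalIntegral.integral_sub (iJ ht₀ h.right_mem) ((iR ht₀ h.right_mem).const_mul _),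
    intervalIntegral.integral_const_mul, intervalIntegral.integral_const_mul,
    h.curve.integral_radial hne hβ h.left_mem ht₀, h.curve.integral_radial hne hβ ht₀ h.right_mem,
    h.norm_left hR, h.norm_right hR, hx₀, Real.one_rpow, excess, jacobiLength,
    ← intervalIntegral.integral_add_adjacent_intervals (iJ h.left_mem ht₀) (iJ ht₀ h.right_mem)]
  ring

theorem abs_mul_radialDeriv_le (hmin : ∀ s, Vmin ≤ V s) {y : Space n} (hy : y ≠ 0)
    (w : Space n) : |√(2 * Vmin) * radialDeriv y w| ≤ angular V y * ‖w‖ := by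
  rw [abs_mul, abs_of_nonneg (Real.sqrt_nonneg _)]
  exact mul_le_mul (le_angular hmin hy) (abs_radialDeriv_le _ _) (abs_nonneg _) (angular_nonneg _)

theorem excess_nonneg (h : IsCompetitor ξm ξp R 1 a b x v) (hR : 0 ≤ R) (hV : Continuous V)
    (hmin : ∀ s, Vmin ≤ V s) {β : ℝ} (hβ : 0 < β) : 0 ≤ excess V Vmin β R a b x v := by
  obtain ⟨t₀, ht₀, -, he⟩ := h.exists_excess_eq hR hV Vmin
  rw [he β hβ]
  refine add_nonneg (intervalIntegral.integral_nonneg ht₀.1 fun t ht => ?_)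
    (intervalIntegral.integral_nonneg ht₀.2 fun t ht => ?_)
  · have := abs_le.1 (abs_mul_radialDeriv_le hmin
      (h.ne_zero one_pos t ⟨ht.1, ht.2.trans ht₀.2⟩) (v t))
    exact mul_nonneg (by positivity) (by linarith)
  · have := abs_le.1 (abs_mul_radialDeriv_le hmin
      (h.ne_zero one_pos t ⟨ht₀.1.trans ht.1, ht.2⟩) (v t))
    exact mul_nonneg (by positivity) (by linarith)

/-- In the representation of `exists_excess_eq`, `β` enters only through `|x|^(β-1)`, which is
nondecreasing in `β` because `|x| ≥ 1`; the other factor is nonnegative. -/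
theorem excess_mono (h : IsCompetitor ξm ξp R 1 a b x v) (hR : 0 ≤ R) (hV : Continuous V)
    (hmin : ∀ s, Vmin ≤ V s) {β β' : ℝ} (hβ : 0 < β) (hββ' : β ≤ β') :
    excess V Vmin β R a b x v ≤ excess V Vmin β' R a b x v := by
  obtain ⟨t₀, ht₀, -, he⟩ := h.exists_excess_eq hR hV Vmin
  have hne := h.ne_zero one_pos
  have hint : ∀ (σ : ℝ) {β : ℝ}, 0 < β → ∀ {s t : ℝ}, s ∈ Icc a b → t ∈ Icc a b →
      IntervalIntegrable (fun t => ‖x t‖ ^ (β - 1) *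
        (angular V (x t) * ‖v t‖ + σ * (√(2 * Vmin) * radialDeriv (x t) (v t)))) volume s t := by
    intro σ β hβ s t hs ht
    have := (h.curve.intervalIntegrable_jacobi hne hV β hs ht).add
      ((h.curve.intervalIntegrable_radial hne hβ hs ht).const_mul (σ * √(2 * Vmin)))
    refine this.congr fun r _ => ?_
    simp only [jacobi]; ring
  have hp : ∀ {t : ℝ}, t ∈ Icc a b → ‖x t‖ ^ (β - 1) ≤ ‖x t‖ ^ (β' - 1) := fun ht =>
    Real.rpow_le_rpow_of_exponent_le (h.le_norm ht) (by linarith)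
  rw [he β hβ, he β' (hβ.trans_le hββ')]
  refine add_le_add (intervalIntegral.integral_mono_on ht₀.1 ?_ ?_ fun t ht => ?_)
    (intervalIntegral.integral_mono_on ht₀.2 ?_ ?_ fun t ht => ?_)
  · simpa using hint 1 hβ h.left_mem ht₀
  · simpa using hint 1 (hβ.trans_le hββ') h.left_mem ht₀
  · have htI : t ∈ Icc a b := ⟨ht.1, ht.2.trans ht₀.2⟩
    have := abs_le.1 (abs_mul_radialDeriv_le hmin (hne t htI) (v t))
    exact mul_le_mul_of_nonneg_right (hp htI) (by linarith)
  · simpa [sub_eq_add_neg] using hint (-1) hβ ht₀ h.right_mem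
  · simpa [sub_eq_add_neg] using hint (-1) (hβ.trans_le hββ') ht₀ h.right_mem
  · have htI : t ∈ Icc a b := ⟨ht₀.1.trans ht.1, ht.2⟩
    have := abs_le.1 (abs_mul_radialDeriv_le hmin (hne t htI) (v t))
    exact mul_le_mul_of_nonneg_right (hp htI) (by linarith)

theorem powerMap (h : IsCompetitor ξm ξp R 1 a b x v) (hR : 0 < R) {p : ℝ} (hp : 0 < p) :
    IsCompetitor ξm ξp (R ^ p) 1 a b (fun t => powerMap p (x t))
      (fun t => powerMapDeriv p (x t) (v t)) where
  curve := h.curve.powerMap (h.ne_zero one_pos) p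
  left := by
    have : R ^ p = R ^ (p - 1) * R := by
      rw [Real.rpow_sub_one hR.ne']; field_simp
    rw [_root_.powerMap, h.norm_left hR.le, h.left, smul_smul, this]
  right := by
    have : R ^ p = R ^ (p - 1) * R := by
      rw [Real.rpow_sub_one hR.ne']; field_simp
    rw [_root_.powerMap, h.norm_right hR.le, h.right, smul_smul, this]
  isLeast := by
    have hne := h.ne_zero one_pos
    obtain ⟨t₀, ht₀, hx₀⟩ := h.isLeast.1
    simp only at hx₀
    refine ⟨⟨t₀, ht₀, ?_⟩, ?_⟩
    · simp only [norm_powerMap p (hne t₀ ht₀), hx₀, Real.one_rpow]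
    · rintro _ ⟨t, ht, rfl⟩
      simp only [norm_powerMap p (hne t ht)]
      exact Real.one_le_rpow (h.le_norm ht) hp.le

/-- The shortening of velocities saves at least `(1 - p²)√(2Vmin) ∫ |x|^(pβ-1) |r'|` of length,
where `r = |x|`. As the radius must go from `R` down to `1` and back, this covers the mismatch
between the radial terms subtracted on the two sides. -/
theorem excess_powerMap_le (h : IsCompetitor ξm ξp R 1 a b x v) (hR : 0 < R) (hV : Continuous V)
    (hmin : ∀ s, Vmin ≤ V s) {β p : ℝ} (hβ : 0 < β) (hp : 0 < p) (hp1 : p ≤ 1) :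
    p * excess V Vmin β (R ^ p) a b (fun t => _root_.powerMap p (x t))
      (fun t => powerMapDeriv p (x t) (v t)) ≤ excess V Vmin (p * β) R a b x v := by
  have hne := h.ne_zero one_pos
  have hy := h.powerMap hR hp
  have hpβ : 0 < p * β := mul_pos hp hβ
  have hp2 : 0 ≤ 1 - p ^ 2 := by nlinarith
  obtain ⟨t₀, ht₀, hx₀⟩ := h.isLeast.1
  simp only at hx₀
  have iR := fun {s t : ℝ} (hs : s ∈ Icc a b) (ht : t ∈ Icc a b) =>
    h.curve.intervalIntegrable_radial hne hpβ hs ht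
  have iA : ∀ {s t : ℝ}, s ∈ Icc a b → t ∈ Icc a b → IntervalIntegrable
      (fun t => ‖x t‖ ^ (p * β - 1) * |radialDeriv (x t) (v t)|) volume s t := fun hs ht =>
    (iR hs ht).abs.congr fun r _ => by
      simp only [abs_mul, abs_of_nonneg (Real.rpow_nonneg (norm_nonneg (x r)) _)]
  -- Each half of the curve, before and after the closest point, has to cross all radii between `1`
  -- and `R`.
  have hlow : 2 * ((R ^ (p * β) - 1) / (p * β)) ≤
      ∫ t in a..b, ‖x t‖ ^ (p * β - 1) * |radialDeriv (x t) (v t)| := by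
    rw [← intervalIntegral.integral_add_adjacent_intervals (iA h.left_mem ht₀)
      (iA ht₀ h.right_mem)]
    have l1 := intervalIntegral.integral_mono_on ht₀.1 (iR h.left_mem ht₀).neg (iA h.left_mem ht₀)
      fun t _ => by
        rw [Pi.neg_apply, ← mul_neg]
        exact mul_le_mul_of_nonneg_left (neg_le_abs _) (by positivity)
    have l2 := intervalIntegral.integral_mono_on ht₀.2 (iR ht₀ h.right_mem) (iA ht₀ h.right_mem)
      fun t _ => mul_le_mul_of_nonneg_left (le_abs_self _) (by positivity)
    simp only [Pi.neg_apply, intervalIntegral.integral_neg] at l1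
    rw [h.curve.integral_radial hne hpβ h.left_mem ht₀, h.norm_left hR.le, hx₀,
      Real.one_rpow] at l1
    rw [h.curve.integral_radial hne hpβ ht₀ h.right_mem, h.norm_right hR.le, hx₀,
      Real.one_rpow] at l2
    have : -((1 - R ^ (p * β)) / (p * β)) = (R ^ (p * β) - 1) / (p * β) := by ring
    linarith
  have iJ := h.curve.intervalIntegrable_jacobi hne hV (p * β) h.left_mem h.right_mem
  have hlen : p * jacobiLength V β a b (fun t => _root_.powerMap p (x t))
      (fun t => powerMapDeriv p (x t) (v t)) ≤ jacobiLength V (p * β) a b x v -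
        (1 - p ^ 2) * √(2 * Vmin) *
          ∫ t in a..b, ‖x t‖ ^ (p * β - 1) * |radialDeriv (x t) (v t)| := by
    unfold jacobiLength
    rw [← intervalIntegral.integral_const_mul, ← intervalIntegral.integral_const_mul,
      ← intervalIntegral.integral_sub iJ ((iA h.left_mem h.right_mem).const_mul _)]
    refine intervalIntegral.integral_mono_on h.curve.lt.le
      ((hy.curve.intervalIntegrable_jacobi (hy.ne_zero one_pos) hV β h.left_mem
        h.right_mem).const_mul p) (iJ.sub ((iA h.left_mem h.right_mem).const_mul _)) fun t ht => ?_
    have hn := norm_pos_iff.2 (hne t ht)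
    have hpm := mul_norm_powerMapDeriv_le hp hp1 (hne t ht) (v t)
    have hj : jacobi V β (_root_.powerMap p (x t)) =
        angular V (x t) * ‖x t‖ ^ (p * (β - 1)) := by
      rw [jacobi, norm_powerMap p (hne t ht), ← Real.rpow_mul hn.le, _root_.powerMap,
        angular_smul (by positivity)]
    have hexp : ‖x t‖ ^ (p * (β - 1)) * ‖x t‖ ^ (p - 1) = ‖x t‖ ^ (p * β - 1) := by
      rw [← Real.rpow_add hn]; congr 1; ring
    calc p * (jacobi V β (_root_.powerMap p (x t)) * ‖powerMapDeriv p (x t) (v t)‖)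
        = angular V (x t) * ‖x t‖ ^ (p * (β - 1)) * (p * ‖powerMapDeriv p (x t) (v t)‖) := by
          rw [hj]; ring
      _ ≤ angular V (x t) * ‖x t‖ ^ (p * (β - 1)) *
          (‖x t‖ ^ (p - 1) * (‖v t‖ - (1 - p ^ 2) * |radialDeriv (x t) (v t)|)) :=
          mul_le_mul_of_nonneg_left hpm (mul_nonneg (angular_nonneg _) (by positivity))
      _ = jacobi V (p * β) (x t) * ‖v t‖ - (1 - p ^ 2) * angular V (x t) *
          (‖x t‖ ^ (p * β - 1) * |radialDeriv (x t) (v t)|) := by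
          rw [jacobi, ← hexp]; ring
      _ ≤ _ := by
          refine sub_le_sub_left (mul_le_mul_of_nonneg_right (mul_le_mul_of_nonneg_left
            (le_angular hmin (hne t ht)) hp2) (by positivity)) _
  unfold excess
  rw [← Real.rpow_mul hR.le]
  have h3 := mul_le_mul_of_nonneg_left hlow (mul_nonneg hp2 (Real.sqrt_nonneg (2 * Vmin)))
  have h4 : p * (2 * (√(2 * Vmin) * ((R ^ (p * β) - 1) / β))) =
      p ^ 2 * √(2 * Vmin) * (2 * ((R ^ (p * β) - 1) / (p * β))) := by
    field_simp
  rw [mul_sub, h4]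
  linarith

/-- Rays in the minimal directions `ξm`, `ξp` add exactly the length that the larger end radius
subtracts. -/
theorem exists_extension (h : IsCompetitor ξm ξp R 1 a b x v) (hR : 0 < R) (hV : Continuous V)
    (hm : V ξm = Vmin) (hp : V ξp = Vmin) {β : ℝ} (hβ : 0 < β) {R' : ℝ} (hRR' : R ≤ R') :
    ∃ a' b' y w, IsCompetitor ξm ξp R' 1 a' b' y w ∧
      excess V Vmin β R' a' b' y w = excess V Vmin β R a b x v := by
  have hR1 : 1 ≤ R := by rw [← h.norm_left hR.le]; exact h.le_norm h.left_mem
  have hne := h.ne_zero one_pos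
  -- The radial speed on added pieces of unit duration. When `R' = R` they are constant, but the
  -- time intervals remain nondegenerate as `IsCurve` requires.
  set k := R' - R with hk
  have hk0 : 0 ≤ k := sub_nonneg.2 hRR'
  have hposl : ∀ t ∈ Icc (a - 1) a, R ≤ (R + k * a) + (-k) * t := fun t ht => by
    nlinarith [ht.2]
  have hposr : ∀ t ∈ Icc b (b + 1), R ≤ (R - k * b) + k * t := fun t ht => by
    nlinarith [ht.1]
  have hal : a - 1 < a := by linarith
  have hbr : b < b + 1 := by linarith
  have cl := isCurve_ray hal (R + k * a) (-k) (ξm : Space n)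
  have cr := isCurve_ray hbr (R - k * b) k (ξp : Space n)
  have nl : ∀ t ∈ Icc (a - 1) a, 1 ≤ ‖((R + k * a) + (-k) * t) • (ξm : Space n)‖ := fun t ht => by
    rw [norm_smul, Real.norm_of_nonneg (hR.le.trans (hposl t ht))]
    simpa using hR1.trans (hposl t ht)
  have nr : ∀ t ∈ Icc b (b + 1), 1 ≤ ‖((R - k * b) + k * t) • (ξp : Space n)‖ := fun t ht => by
    rw [norm_smul, Real.norm_of_nonneg (hR.le.trans (hposr t ht))]
    simpa using hR1.trans (hposr t ht)
  have nel : ∀ t ∈ Icc (a - 1) a, ((R + k * a) + (-k) * t) • (ξm : Space n) ≠ 0 := fun t ht =>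
    norm_pos_iff.1 (one_pos.trans_le (nl t ht))
  have ner : ∀ t ∈ Icc b (b + 1), ((R - k * b) + k * t) • (ξp : Space n) ≠ 0 := fun t ht =>
    norm_pos_iff.1 (one_pos.trans_le (nr t ht))
  have c1 := h.curve.concat cr (by rw [h.right]; congr 1; ring)
  have n1 : ∀ t ∈ Icc a (b + 1), 1 ≤ ‖if t ≤ b then x t else
      ((R - k * b) + k * t) • (ξp : Space n)‖ := fun t ht => by
    split_ifs with htb
    · exact h.le_norm ⟨ht.1, htb⟩
    · exact nr t ⟨(not_le.1 htb).le, ht.2⟩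
  have ne1 : ∀ t ∈ Icc a (b + 1), (if t ≤ b then x t else
      ((R - k * b) + k * t) • (ξp : Space n)) ≠ 0 := fun t ht =>
    norm_pos_iff.1 (one_pos.trans_le (n1 t ht))
  have c2 := cl.concat c1 (by
    simp only [h.curve.lt.le, if_true]
    rw [h.left]; congr 1; ring)
  refine ⟨a - 1, b + 1, _, _, ⟨c2, ?_, ?_, ?_⟩, ?_⟩
  · simp only [hal.le, if_true]
    congr 1; rw [hk]; ring
  · simp only [not_le.2 (h.curve.lt.trans hbr), not_le.2 hbr, if_false]
    congr 1; rw [hk]; ring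
  · constructor
    · obtain ⟨t₀, ht₀, hx₀⟩ := h.isLeast.1
      refine ⟨t₀, ⟨by linarith [ht₀.1], by linarith [ht₀.2]⟩, ?_⟩
      simp only at hx₀ ⊢
      refine Eq.trans ?_ hx₀
      rcases eq_or_lt_of_le ht₀.1 with he | hlt
      · rw [if_pos he.symm.le, ← he, h.left]
        congr 2; ring
      · rw [if_neg (not_le.2 hlt), if_pos ht₀.2]
    · rintro _ ⟨t, ht, rfl⟩
      simp only
      split_ifs with h1 h2
      · exact nl t ⟨ht.1, h1⟩
      · exact h.le_norm ⟨(not_le.1 h1).le, h2⟩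
      · exact nr t ⟨(not_le.1 h2).le, ht.2⟩
  · unfold excess
    rw [jacobiLength_concat cl c1 nel ne1 hV, jacobiLength_concat h.curve cr hne ner hV,
      jacobiLength_ray hal ξm (fun t ht => hR.trans_le (hposl t ht)) hβ,
      jacobiLength_ray hbr ξp (fun t ht => hR.trans_le (hposr t ht)) hβ, hm, hp]
    have e1 : R + k * a + -k * a = R := by ring
    have e2 : R + k * a + -k * (a - 1) = R' := by rw [hk]; ring
    have e3 : R - k * b + k * b = R := by ring
    have e4 : R - k * b + k * (b + 1) = R' := by rw [hk]; ring
    have hpow : R ^ β ≤ R' ^ β := Real.rpow_le_rpow hR.le hRR' hβ.le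
    rw [e1, e2, e3, e4, abs_of_nonpos (by linarith), abs_of_nonneg (by linarith)]
    ring

end IsCompetitor

/-- An arc of great circle. -/
theorem exists_competitor {n : ℕ} (hn : 1 ≤ n) {ξm ξp : Sph n} (hξ : ξm ≠ ξp) :
    ∃ a b x v, IsCompetitor ξm ξp 1 1 a b x v := by
  have hm : ‖(ξm : Space n)‖ = 1 := by simp
  have hp : ‖(ξp : Space n)‖ = 1 := by simp
  obtain ⟨θ, hθ, u, hu, hmu, hpu⟩ : ∃ θ > 0, ∃ u : Space n, ‖u‖ = 1 ∧ inner ℝ (ξm : Space n) u = 0 ∧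
      (ξp : Space n) = Real.cos θ • (ξm : Space n) + Real.sin θ • u := by
    set c := inner ℝ (ξm : Space n) (ξp : Space n) with hc
    set w := (ξp : Space n) - c • (ξm : Space n) with hw
    have hmw : inner ℝ (ξm : Space n) w = 0 := by
      rw [hw, inner_sub_right, inner_smul_right, real_inner_self_eq_norm_sq, hm, ← hc]; ring
    have hc1 : |c| ≤ 1 := by
      have := abs_real_inner_le_norm (ξm : Space n) (ξp : Space n)
      rwa [hm, hp, mul_one] at this
    have hww : ‖w‖ ^ 2 = 1 - c ^ 2 := by
      rw [hw, norm_sub_sq_real, norm_smul, inner_smul_right, real_inner_comm, ← hc, hm, hp,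
        mul_one, Real.norm_eq_abs, sq_abs]; ring
    -- If `ξp` is a multiple of `ξm`, the points are antipodal and the direction `u` is free: any
    -- unit vector orthogonal to `ξm` will do, and one exists since `n ≥ 1`.
    by_cases hw0 : w = 0
    · have hpm : (ξp : Space n) = c • (ξm : Space n) := sub_eq_zero.1 hw0
      have hcm : c = -1 := by
        rw [hw0, norm_zero] at hww
        have : (c - 1) * (c + 1) = 0 := by nlinarith
        rcases mul_eq_zero.1 this with h | h
        · exfalso
          apply hξ
          apply Subtype.ext
          rw [hpm, sub_eq_zero.1 h, one_smul]
        · linarith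
      obtain ⟨z, hz0, hz⟩ : ∃ z : Space n, z ≠ 0 ∧ inner ℝ (ξm : Space n) z = 0 := by
        have hfr : Module.finrank ℝ (ℝ ∙ (ξm : Space n))ᗮ = n := by
          have : Fact (Module.finrank ℝ (Space n) = n + 1) := ⟨by simp⟩
          exact Submodule.finrank_orthogonal_span_singleton (by
            intro h0; rw [h0, norm_zero] at hm; exact zero_ne_one hm)
        have : Nontrivial (ℝ ∙ (ξm : Space n))ᗮ := by
          apply Module.nontrivial_of_finrank_pos (R := ℝ)
          omega
        obtain ⟨z, hz⟩ := exists_ne (0 : (ℝ ∙ (ξm : Space n))ᗮ)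
        exact ⟨z, fun h0 => hz (Subtype.ext h0),
          (Submodule.mem_orthogonal_singleton_iff_inner_right).1 z.2⟩
      refine ⟨Real.pi, Real.pi_pos, ‖z‖⁻¹ • z, ?_, ?_, ?_⟩
      · rw [norm_smul, norm_inv, norm_norm, inv_mul_cancel₀ (norm_ne_zero_iff.2 hz0)]
      · rw [inner_smul_right, hz, mul_zero]
      · rw [hpm, hcm]; simp
    · have hwn : 0 < ‖w‖ := norm_pos_iff.2 hw0
      have hcc := abs_le.1 hc1
      have hcos : Real.cos (Real.arccos c) = c := Real.cos_arccos hcc.1 hcc.2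
      have hsin : Real.sin (Real.arccos c) = ‖w‖ := by
        rw [Real.sin_arccos, ← hww, Real.sqrt_sq hwn.le]
      refine ⟨Real.arccos c, ?_, ‖w‖⁻¹ • w, ?_, ?_, ?_⟩
      · rw [gt_iff_lt, Real.arccos_pos]
        by_contra hge
        have : c = 1 := le_antisymm hcc.2 (not_lt.1 hge)
        rw [this] at hww
        nlinarith
      · rw [norm_smul, norm_inv, norm_norm, inv_mul_cancel₀ hwn.ne']
      · rw [inner_smul_right, hmw, mul_zero]
      · rw [hcos, hsin, smul_smul, mul_inv_cancel₀ hwn.ne', one_smul, hw]; abel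
  have hx : ∀ t : ℝ, ‖Real.cos t • (ξm : Space n) + Real.sin t • u‖ = 1 := fun t => by
    have : ‖Real.cos t • (ξm : Space n) + Real.sin t • u‖ ^ 2 = 1 := by
      rw [norm_add_sq_real, norm_smul, norm_smul, inner_smul_left, inner_smul_right, hmu, hm, hu,
        mul_one, mul_one, Real.norm_eq_abs, Real.norm_eq_abs, sq_abs, sq_abs]
      simp
    exact (pow_eq_one_iff_of_nonneg (norm_nonneg _) two_ne_zero).1 this
  have hd : ∀ t : ℝ, HasDerivAt (fun t => Real.cos t • (ξm : Space n) + Real.sin t • u)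
      ((-Real.sin t) • (ξm : Space n) + Real.cos t • u) t := fun t =>
    ((Real.hasDerivAt_cos t).smul_const _).add ((Real.hasDerivAt_sin t).smul_const _)
  have hcont : Continuous fun t => (-Real.sin t) • (ξm : Space n) + Real.cos t • u := by fun_prop
  refine ⟨0, θ, fun t => Real.cos t • (ξm : Space n) + Real.sin t • u, _,
    ⟨⟨hθ, hcont.intervalIntegrable 0 θ, fun t ht => ?_⟩, ?_, ?_, ?_⟩⟩
  · rw [intervalIntegral.integral_eq_sub_of_hasDerivAt (fun s _ => hd s)
      (hcont.intervalIntegrable 0 t)]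
    abel
  · simp
  · simp only [one_smul, hpu]
  · simp only [hx]
    exact ⟨⟨0, ⟨le_rfl, hθ.le⟩, rfl⟩, by rintro _ ⟨_, _, rfl⟩; exact le_rfl⟩

/-! ### The Bolza level as an infimum of Jacobi lengths -/

section bolza

variable {n : ℕ} {ξm ξp : Sph n} {V : Sph n → ℝ} {Vmin : ℝ}

/-- Nonvanishing is asked only almost everywhere, so that the collision path of `ε = 0` is covered
as well. The bound comes from `exists_action_le` with `η → 0`. -/
theorem bolzaLevel_le_of_integrable (h0 : 0 < Vmin) (hmin : ∀ s, Vmin ≤ V s) (hV : Continuous V)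
    {β : ℝ} (hβ : β ≤ 1) {ε a b : ℝ} {x v : ℝ → Space n} (h : IsCompetitor ξm ξp 1 ε a b x v)
    (hne : ∀ᵐ t ∂volume.restrict (Icc a b), x t ≠ 0)
    (hw : IntervalIntegrable (fun t => jacobi V β (x t)) volume a b)
    (hJ : IntervalIntegrable (fun t => jacobi V β (x t) * ‖v t‖) volume a b) :
    bolzaLevel ξm ξp V (2 - 2 * β) ε ≤ ENNReal.ofReal (jacobiLength V β a b x v) := by
  have key : ∀ η > 0, bolzaLevel ξm ξp V (2 - 2 * β) ε ≤ ENNReal.ofReal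
      ((∫ t in a..b, jacobi V β (x t) * ‖v t‖) + η * ∫ t in a..b, jacobi V β (x t)) := by
    intro η hη
    obtain ⟨T, hT, y, w, h1, h2, h3, h4, h5⟩ :=
      h.curve.exists_action_le h0 hmin hV hβ hne hw hJ hη
    have hpath : IsConstrainedPath T (ξm : Space n) ξp ε y w :=
      ⟨h1, by rw [h2, h.left, one_smul], by rw [h3, h.right, one_smul], by rw [h4]; exact h.isLeast⟩
    have hmem : action V (2 - 2 * β) (-T) T y w ∈ actionLevels V (2 - 2 * β) (ξm : Space n) ξp ε :=
      ⟨T, hT, y, w, hpath, rfl⟩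
    exact (sInf_le hmem).trans h5
  have hlim : Tendsto (fun η => ENNReal.ofReal ((∫ t in a..b, jacobi V β (x t) * ‖v t‖) +
      η * ∫ t in a..b, jacobi V β (x t))) (𝓝[>] (0 : ℝ))
      (𝓝 (ENNReal.ofReal (jacobiLength V β a b x v))) := by
    have hc : Continuous fun η : ℝ => ENNReal.ofReal ((∫ t in a..b, jacobi V β (x t) * ‖v t‖) +
      η * ∫ t in a..b, jacobi V β (x t)) :=
      ENNReal.continuous_ofReal.comp (by fun_prop)
    have := (hc.tendsto 0).mono_left (nhdsWithin_le_nhds (s := Ioi 0))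
    simpa [jacobiLength] using this
  exact ge_of_tendsto hlim (eventually_mem_nhdsWithin.mono fun η hη => key η hη)

theorem bolzaLevel_le (h0 : 0 < Vmin) (hmin : ∀ s, Vmin ≤ V s) (hV : Continuous V)
    {β : ℝ} (hβ : β ≤ 1) {ε : ℝ} (hε : 0 < ε) {a b : ℝ} {x v : ℝ → Space n}
    (h : IsCompetitor ξm ξp 1 ε a b x v) :
    bolzaLevel ξm ξp V (2 - 2 * β) ε ≤ ENNReal.ofReal (jacobiLength V β a b x v) := by
  have hne := h.ne_zero hε
  refine bolzaLevel_le_of_integrable h0 hmin hV hβ h ?_ ?_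
    (h.curve.intervalIntegrable_jacobi hne hV β h.left_mem h.right_mem)
  · filter_upwards [ae_restrict_mem measurableSet_Icc] with t ht using hne t ht
  · refine ContinuousOn.intervalIntegrable ?_
    rw [uIcc_of_le h.curve.lt.le]
    exact h.curve.jacobi_continuousOn hne hV β

theorem IsConstrainedPath.isCompetitor {T ε : ℝ} (hT : 0 < T) {x v : ℝ → Space n}
    (h : IsConstrainedPath T (ξm : Space n) ξp ε x v) : IsCompetitor ξm ξp 1 ε (-T) T x v where
  curve := by
    have hle : -T < T := by linarith
    refine ⟨hle, ?_, h.h1.eq_integral⟩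
    rw [intervalIntegrable_iff_integrableOn_Icc_of_le hle.le]
    exact h.h1.memLp.integrable one_le_two
  left := by rw [h.left, one_smul]
  right := by rw [h.right, one_smul]
  isLeast := h.isLeast

/-- An almost minimising path for the action works, since its Jacobi length is no larger than its
action. -/
theorem exists_competitor_le (h0 : 0 < Vmin) (hmin : ∀ s, Vmin ≤ V s) (hV : Continuous V)
    {β : ℝ} {ε : ℝ} (hε : 0 < ε) (hfin : bolzaLevel ξm ξp V (2 - 2 * β) ε ≠ ⊤)
    {η : ℝ} (hη : 0 < η) : ∃ a b x v, IsCompetitor ξm ξp 1 ε a b x v ∧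
      jacobiLength V β a b x v ≤ (bolzaLevel ξm ξp V (2 - 2 * β) ε).toReal + η := by
  have hlt : bolzaLevel ξm ξp V (2 - 2 * β) ε <
      bolzaLevel ξm ξp V (2 - 2 * β) ε + ENNReal.ofReal η :=
    ENNReal.lt_add_right hfin (by simpa using hη)
  obtain ⟨A, ⟨T, hT, x, v, hp, rfl⟩, hA⟩ := sInf_lt_iff.1 hlt
  have hc := hp.isCompetitor hT
  refine ⟨-T, T, x, v, hc, ?_⟩
  have hJ := hc.curve.intervalIntegrable_jacobi (hc.ne_zero hε) hV β hc.left_mem hc.right_mem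
  have h1 : ENNReal.ofReal (jacobiLength V β (-T) T x v) ≤ action V (2 - 2 * β) (-T) T x v := by
    rw [jacobiLength, intervalIntegral.integral_of_le hc.curve.lt.le,
      ← integral_Icc_eq_integral_Ioc, ofReal_integral_eq_lintegral_ofReal
        ((intervalIntegrable_iff_integrableOn_Icc_of_le hc.curve.lt.le).1 hJ)
        (ae_of_all _ fun t => mul_nonneg (jacobi_nonneg _ _) (norm_nonneg _))]
    exact lintegral_mono fun t => ofReal_jacobi_le h0 hmin β _ _
  have h2 := h1.trans hA.le
  rw [← ENNReal.ofReal_toReal hfin, ← ENNReal.ofReal_add ENNReal.toReal_nonneg hη.le] at h2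
  exact (ENNReal.ofReal_le_ofReal_iff (by positivity)).1 h2

/-- A path through the origin brings its radius from `1` to `0` and back, and `J |v|` dominates
`√(2Vmin)/β` times the rate of change of `|x|^β`. That power is replaced by `(|x|² + δ)^(β/2)` to be
differentiable at the collision. -/
theorem le_action_of_zero (h0 : 0 < Vmin) (hmin : ∀ s, Vmin ≤ V s) {β : ℝ} (hβ : 0 < β)
    (hβ1 : β ≤ 1) {T : ℝ} (hT : 0 < T) {x v : ℝ → Space n}
    (h : IsConstrainedPath T (ξm : Space n) ξp 0 x v) :
    ENNReal.ofReal (2 * √(2 * Vmin) / β) ≤ action V (2 - 2 * β) (-T) T x v := by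
  have hc := h.isCompetitor hT
  obtain ⟨t₀, ht₀, hx₀⟩ := hc.isLeast.1
  simp only at hx₀
  have hcpos : 0 < √(2 * Vmin) := by positivity
  have key : ∀ δ > 0, ENNReal.ofReal (2 * √(2 * Vmin) / β *
      ((1 + δ) ^ (β / 2) - δ ^ (β / 2))) ≤ action V (2 - 2 * β) (-T) T x v := by
    intro δ hδ
    have hF := hc.curve.sq_norm_add_rpow hδ (β / 2)
    set d : ℝ → ℝ := fun t => 2 * (β / 2) * (‖x t‖ ^ 2 + δ) ^ (β / 2 - 1) * inner ℝ (x t) (v t)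
      with hd
    have hpt : ∀ t, √(2 * Vmin) / β * |d t| ≤ jacobi V β (x t) * ‖v t‖ := by
      intro t
      -- At the origin both sides vanish: `angular` takes the value `0` there.
      by_cases hxt : x t = 0
      · simp [hd, hxt, jacobi, angular]
      · have hn := norm_pos_iff.2 hxt
        have e1 : (‖x t‖ ^ 2 + δ) ^ (β / 2 - 1) ≤ ‖x t‖ ^ (β - 2) := by
          have : ‖x t‖ ^ (β - 2) = (‖x t‖ ^ 2) ^ (β / 2 - 1) := by
            rw [← Real.rpow_natCast, ← Real.rpow_mul hn.le]
            congr 1; push_cast; ring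
          rw [this]
          exact Real.rpow_le_rpow_of_nonpos (by positivity) (by linarith) (by linarith)
        have e2 : ‖x t‖ ^ (β - 1) = ‖x t‖ ^ (β - 2) * ‖x t‖ := by
          rw [← Real.rpow_add_one hn.ne']
          congr 1; ring
        have e3 : |d t| ≤ β * (‖x t‖ ^ (β - 1) * ‖v t‖) := by
          simp only [hd]
          rw [abs_mul, abs_of_nonneg (by positivity), e2]
          calc 2 * (β / 2) * (‖x t‖ ^ 2 + δ) ^ (β / 2 - 1) * |inner ℝ (x t) (v t)|
              ≤ 2 * (β / 2) * ‖x t‖ ^ (β - 2) * (‖x t‖ * ‖v t‖) :=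
                mul_le_mul (mul_le_mul_of_nonneg_left e1 (by positivity))
                  (abs_real_inner_le_norm _ _) (abs_nonneg _) (by positivity)
            _ = _ := by ring
        calc √(2 * Vmin) / β * |d t| ≤ √(2 * Vmin) / β * (β * (‖x t‖ ^ (β - 1) * ‖v t‖)) :=
              mul_le_mul_of_nonneg_left e3 (by positivity)
          _ = √(2 * Vmin) * ‖x t‖ ^ (β - 1) * ‖v t‖ := by field_simp
          _ ≤ _ := mul_le_mul_of_nonneg_right (le_jacobi hmin β hxt) (norm_nonneg _)
    have hdI : IntegrableOn (fun t => √(2 * Vmin) / β * |d t|) (Icc (-T) T) :=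
      ((intervalIntegrable_iff_integrableOn_Icc_of_le hc.curve.lt.le).1
        hF.integrable).abs.const_mul _
    -- Splitting at a collision time `t₀`: on each half the regularised power changes by `(1 +
    -- δ)^(β/2) - δ^(β/2)`.
    have i1 : (∫ t in (-T)..t₀, |d t|) + ∫ t in t₀..T, |d t| = ∫ t in (-T)..T, |d t| :=
      intervalIntegral.integral_add_adjacent_intervals
        ((hF.integrable_sub hc.left_mem ht₀).abs) ((hF.integrable_sub ht₀ hc.right_mem).abs)
    have s1 := hF.sub_eq hc.left_mem ht₀
    have s2 := hF.sub_eq ht₀ hc.right_mem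
    have l1 := intervalIntegral.norm_integral_le_integral_norm (f := d) (μ := volume) ht₀.1
    have l2 := intervalIntegral.norm_integral_le_integral_norm (f := d) (μ := volume) ht₀.2
    simp only [Real.norm_eq_abs] at l1 l2
    rw [← s1] at l1
    rw [← s2] at l2
    simp only [hx₀, hc.norm_left zero_le_one] at l1
    simp only [hx₀, hc.norm_right zero_le_one] at l2
    have hlow : 2 * √(2 * Vmin) / β * ((1 + δ) ^ (β / 2) - δ ^ (β / 2)) ≤
        ∫ t in Icc (-T) T, √(2 * Vmin) / β * |d t| := by
      rw [integral_Icc_eq_integral_Ioc, ← intervalIntegral.integral_of_le hc.curve.lt.le,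
        intervalIntegral.integral_const_mul, ← i1]
      have : 2 * ((1 + δ) ^ (β / 2) - δ ^ (β / 2)) ≤
          (∫ t in (-T)..t₀, |d t|) + ∫ t in t₀..T, |d t| := by
        norm_num at l1 l2
        have := (neg_le_abs _).trans l1
        have := (le_abs_self _).trans l2
        linarith
      calc _ = √(2 * Vmin) / β * (2 * ((1 + δ) ^ (β / 2) - δ ^ (β / 2))) := by ring
        _ ≤ _ := mul_le_mul_of_nonneg_left this (by positivity)
    refine (ENNReal.ofReal_le_ofReal hlow).trans ?_
    rw [ofReal_integral_eq_lintegral_ofReal hdI (ae_of_all _ fun t => by positivity)]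
    exact lintegral_mono fun t => (ENNReal.ofReal_le_ofReal (hpt t)).trans
      (ofReal_jacobi_le h0 hmin β _ _)
  have hlim : Tendsto (fun δ : ℝ => ENNReal.ofReal (2 * √(2 * Vmin) / β *
      ((1 + δ) ^ (β / 2) - δ ^ (β / 2)))) (𝓝[>] 0) (𝓝 (ENNReal.ofReal (2 * √(2 * Vmin) / β))) := by
    have hc : ContinuousAt (fun δ : ℝ => ENNReal.ofReal (2 * √(2 * Vmin) / β *
      ((1 + δ) ^ (β / 2) - δ ^ (β / 2)))) 0 := by
      refine ENNReal.continuous_ofReal.continuousAt.comp ?_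
      refine continuousAt_const.mul (ContinuousAt.sub ?_ ?_)
      · exact (continuousAt_const.add continuousAt_id).rpow_const (Or.inl (by simp))
      · exact continuousAt_id.rpow_const (Or.inr (by positivity))
    have := hc.tendsto.mono_left (nhdsWithin_le_nhds (s := Ioi 0))
    rwa [add_zero, Real.one_rpow, Real.zero_rpow (by positivity), sub_zero, mul_one] at this
  exact le_of_tendsto hlim (eventually_mem_nhdsWithin.mono fun δ hδ => key δ hδ)

theorem integral_abs_rpow {β : ℝ} (hβ : 0 < β) :
    IntervalIntegrable (fun t : ℝ => |t| ^ (β - 1)) volume (-1) 1 ∧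
      ∫ t in (-1 : ℝ)..1, |t| ^ (β - 1) = 2 / β := by
  have hb : -1 < β - 1 := by linarith
  have e : ∀ t ∈ uIoc (0 : ℝ) 1, t ^ (β - 1) = |t| ^ (β - 1) := fun t ht => by
    rw [uIoc_of_le zero_le_one] at ht
    rw [abs_of_pos ht.1]
  have i1 : IntervalIntegrable (fun t : ℝ => |t| ^ (β - 1)) volume 0 1 :=
    (intervalIntegral.intervalIntegrable_rpow' hb).congr e
  have i2 : IntervalIntegrable (fun t : ℝ => |t| ^ (β - 1)) volume (-1) 0 := by
    rw [IntervalIntegrable.iff_comp_neg]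
    simpa using i1.symm
  refine ⟨i2.trans i1, ?_⟩
  have h1 : ∫ t in (0 : ℝ)..1, |t| ^ (β - 1) = 1 / β := by
    rw [← intervalIntegral.integral_congr_ae (ae_of_all _ e), integral_rpow (Or.inl hb)]
    simp [hβ.ne']
  have h2 : ∫ t in (-1 : ℝ)..0, |t| ^ (β - 1) = 1 / β := by
    rw [← h1]
    have := intervalIntegral.integral_comp_neg (a := (-1 : ℝ)) (b := 0)
      (fun t : ℝ => |t| ^ (β - 1))
    simpa using this
  rw [← intervalIntegral.integral_add_adjacent_intervals i2 i1, h1, h2]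
  ring

/-- The minimal length is that of the broken ray `ξm → 0 → ξp`, finite because `r^(β-1)` is
integrable at `0`. -/
theorem bolzaLevel_zero (h0 : 0 < Vmin) (hmin : ∀ s, Vmin ≤ V s) (hV : Continuous V)
    (hm : V ξm = Vmin) (hp : V ξp = Vmin) {β : ℝ} (hβ : 0 < β) (hβ1 : β ≤ 1) :
    bolzaLevel ξm ξp V (2 - 2 * β) 0 = ENNReal.ofReal (2 * √(2 * Vmin) / β) := by
  refine le_antisymm ?_ (le_sInf ?_)
  · have c := (isCurve_ray (show (-1 : ℝ) < 0 by norm_num) 0 (-1) (ξm : Space n)).concat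
      (isCurve_ray (show (0 : ℝ) < 1 by norm_num) 0 1 (ξp : Space n)) (by simp)
    set x : ℝ → Space n := fun t => if t ≤ 0 then (0 + -1 * t) • (ξm : Space n) else
      (0 + 1 * t) • (ξp : Space n) with hx
    set v : ℝ → Space n := fun t => if t ≤ 0 then (-1 : ℝ) • (ξm : Space n) else
      (1 : ℝ) • (ξp : Space n) with hv
    have hnx : ∀ t, ‖x t‖ = |t| := fun t => by
      simp only [hx]
      split_ifs with ht
      · rw [norm_smul]; simp
      · rw [norm_smul]; simp
    have hnv : ∀ t, ‖v t‖ = 1 := fun t => by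
      simp only [hv]
      split_ifs <;> simp
    have hj : ∀ t, t ≠ 0 → jacobi V β (x t) = √(2 * Vmin) * |t| ^ (β - 1) := fun t ht => by
      rw [jacobi, hnx]
      congr 1
      simp only [hx]
      split_ifs with ht0
      · rw [angular_smul (by have := lt_of_le_of_ne ht0 ht; linarith), angular_coe, hm]
      · rw [angular_smul (by have := not_le.1 ht0; linarith), angular_coe, hp]
    obtain ⟨hi, hint⟩ := integral_abs_rpow hβ
    have hae : ∀ᵐ t : ℝ, t ≠ 0 := by simp [ae_iff]
    have hae' : ∀ᵐ t : ℝ, t ∈ uIoc (-1 : ℝ) 1 →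
        √(2 * Vmin) * |t| ^ (β - 1) = jacobi V β (x t) :=
      hae.mono fun t ht _ => (hj t ht).symm
    have hw : IntervalIntegrable (fun t => jacobi V β (x t)) volume (-1) 1 :=
      (hi.const_mul (√(2 * Vmin))).congr_ae
        ((ae_restrict_iff' measurableSet_uIoc).2 hae')
    have hcomp : IsCompetitor ξm ξp 1 0 (-1) 1 x v := by
      refine ⟨c, ?_, ?_, ?_⟩
      · simp [hx]
      · simp [hx]
      · simp only [hnx]
        refine ⟨⟨0, by norm_num, by simp⟩, ?_⟩
        rintro _ ⟨t, _, rfl⟩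
        exact abs_nonneg t
    refine (bolzaLevel_le_of_integrable h0 hmin hV hβ1 hcomp ?_ hw (by simpa [hnv] using hw)).trans
      (ENNReal.ofReal_le_ofReal (le_of_eq ?_))
    · filter_upwards [ae_restrict_of_ae hae] with t ht
      rw [← norm_ne_zero_iff, hnx]
      exact abs_ne_zero.2 ht
    · simp only [jacobiLength, hnv, mul_one]
      rw [← intervalIntegral.integral_congr_ae hae', intervalIntegral.integral_const_mul, hint]
      ring
  · rintro _ ⟨T, hT, x, v, h, rfl⟩
    exact le_action_of_zero h0 hmin hβ hβ1 hT h

end bolza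

/-! ### The least excess as a function of `β` -/

/-- The infimum of the excess over all competitors at distance `1` from the origin. -/
def minExcess {n : ℕ} (ξm ξp : Sph n) (V : Sph n → ℝ) (Vmin β : ℝ) : ℝ :=
  sInf {e | ∃ R a b x v, 0 < R ∧ IsCompetitor ξm ξp R 1 a b x v ∧
    e = excess V Vmin β R a b x v}

section minExcess

variable {n : ℕ} {ξm ξp : Sph n} {V : Sph n → ℝ} {Vmin : ℝ}

theorem minExcess_le (hV : Continuous V) (hmin : ∀ s, Vmin ≤ V s) {β : ℝ} (hβ : 0 < β)
    {R a b : ℝ} {x v : ℝ → Space n} (hR : 0 < R) (h : IsCompetitor ξm ξp R 1 a b x v) :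
    minExcess ξm ξp V Vmin β ≤ excess V Vmin β R a b x v := by
  refine csInf_le ⟨0, ?_⟩ ⟨R, a, b, x, v, hR, h, rfl⟩
  rintro _ ⟨R, a, b, x, v, hR, h, rfl⟩
  exact h.excess_nonneg hR.le hV hmin hβ

/-- The great-circle arc makes the set of values nonempty; `sInf` of the empty set would be the
default `0`. -/
theorem le_minExcess (hn : 1 ≤ n) (hξ : ξm ≠ ξp) {β m : ℝ}
    (h : ∀ R a b x v, 0 < R → IsCompetitor ξm ξp R 1 a b x v → m ≤ excess V Vmin β R a b x v) :
    m ≤ minExcess ξm ξp V Vmin β := by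
  obtain ⟨a, b, x, v, hc⟩ := exists_competitor hn hξ
  refine le_csInf ⟨_, 1, a, b, x, v, one_pos, hc, rfl⟩ ?_
  rintro _ ⟨R, a, b, x, v, hR, h', rfl⟩
  exact h R a b x v hR h'

theorem exists_excess_lt (hn : 1 ≤ n) (hξ : ξm ≠ ξp) {β m : ℝ}
    (hm : minExcess ξm ξp V Vmin β < m) : ∃ R a b x v, 0 < R ∧
      IsCompetitor ξm ξp R 1 a b x v ∧ excess V Vmin β R a b x v < m := by
  by_contra! hcon
  exact hm.not_ge (le_minExcess hn hξ hcon)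

theorem minExcess_mono (hn : 1 ≤ n) (hξ : ξm ≠ ξp) (hV : Continuous V) (hmin : ∀ s, Vmin ≤ V s)
    {β β' : ℝ} (hβ : 0 < β) (hββ' : β ≤ β') :
    minExcess ξm ξp V Vmin β ≤ minExcess ξm ξp V Vmin β' :=
  le_minExcess hn hξ fun _ _ _ _ _ hR h =>
    (minExcess_le hV hmin hβ hR h).trans (h.excess_mono hR.le hV hmin hβ hββ')

/-- Apply the power map with `p = β/β'`, which carries competitors to competitors. This is the
reverse of `minExcess_mono` up to a factor tending to `1` as `β → β'`. -/
theorem mul_minExcess_le (hn : 1 ≤ n) (hξ : ξm ≠ ξp) (hV : Continuous V) (hmin : ∀ s, Vmin ≤ V s)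
    {β β' : ℝ} (hβ : 0 < β) (hββ' : β ≤ β') :
    β / β' * minExcess ξm ξp V Vmin β' ≤ minExcess ξm ξp V Vmin β := by
  have hβ' := hβ.trans_le hββ'
  have hp : 0 < β / β' := div_pos hβ hβ'
  refine le_minExcess hn hξ fun R a b x v hR h => ?_
  have h1 := h.excess_powerMap_le hR hV hmin hβ' hp ((div_le_one hβ').2 hββ')
  rw [div_mul_cancel₀ _ hβ'.ne'] at h1
  exact (mul_le_mul_of_nonneg_left (minExcess_le hV hmin hβ' (by positivity) (h.powerMap hR hp))
    hp.le).trans h1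

/-- Squeeze of `G(β)` between `min(1, β/β₀) G(β₀)` and `max(1, β/β₀) G(β₀)`. -/
theorem minExcess_continuousOn (hn : 1 ≤ n) (hξ : ξm ≠ ξp) (hV : Continuous V)
    (hmin : ∀ s, Vmin ≤ V s) : ContinuousOn (minExcess ξm ξp V Vmin) (Ioi 0) := by
  intro β₀ hβ₀
  have hβ₀' : 0 < β₀ := hβ₀
  have hc : ContinuousAt (fun β : ℝ => β / β₀) β₀ := continuousAt_id.div_const _
  have l1 : Tendsto (fun β => min 1 (β / β₀) * minExcess ξm ξp V Vmin β₀) (𝓝[Ioi 0] β₀)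
      (𝓝 (minExcess ξm ξp V Vmin β₀)) := by
    have := (((continuousAt_const (y := (1 : ℝ))).min hc).mul
      (continuousAt_const (y := minExcess ξm ξp V Vmin β₀))).mono_left
      (nhdsWithin_le_nhds (s := Ioi 0))
    simpa [div_self hβ₀'.ne'] using this
  have l2 : Tendsto (fun β => max 1 (β / β₀) * minExcess ξm ξp V Vmin β₀) (𝓝[Ioi 0] β₀)
      (𝓝 (minExcess ξm ξp V Vmin β₀)) := by
    have := (((continuousAt_const (y := (1 : ℝ))).max hc).mul
      (continuousAt_const (y := minExcess ξm ξp V Vmin β₀))).mono_left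
      (nhdsWithin_le_nhds (s := Ioi 0))
    simpa [div_self hβ₀'.ne'] using this
  refine tendsto_of_tendsto_of_tendsto_of_le_of_le' l1 l2 ?_ ?_
  all_goals
    filter_upwards [self_mem_nhdsWithin] with β hβ
    have hβ : 0 < β := hβ
    rcases le_total β β₀ with hle | hle
  · rw [min_eq_right ((div_le_one hβ₀').2 hle)]
    exact mul_minExcess_le hn hξ hV hmin hβ hle
  · rw [min_eq_left ((one_le_div hβ₀').2 hle), one_mul]
    exact minExcess_mono hn hξ hV hmin hβ₀' hle
  · rw [max_eq_left ((div_le_one hβ₀').2 hle), one_mul]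
    exact minExcess_mono hn hξ hV hmin hβ hle
  · rw [max_eq_right ((one_le_div hβ₀').2 hle)]
    have := mul_minExcess_le hn hξ hV hmin hβ₀' hle
    rw [div_mul_eq_mul_div, div_le_iff₀ hβ] at this
    rw [div_mul_eq_mul_div, le_div_iff₀ hβ₀']
    linarith

end minExcess

/-! ### The limit of `γ((V,α),ε)` as `ε → 0⁺` -/

section gamma

variable {n : ℕ} {ξm ξp : Sph n} {V : Sph n → ℝ} {Vmin : ℝ}

/-- Extending a competitor by rays and rescaling it. -/
theorem bolzaLevel_le_excess (h0 : 0 < Vmin) (hmin : ∀ s, Vmin ≤ V s) (hV : Continuous V)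
    (hm : V ξm = Vmin) (hp : V ξp = Vmin) {β : ℝ} (hβ : 0 < β) (hβ1 : β ≤ 1) {ε : ℝ} (hε : 0 < ε)
    {R a b : ℝ} {x v : ℝ → Space n} (hR : 0 < R) (h : IsCompetitor ξm ξp R 1 a b x v)
    (hRε : R ≤ ε⁻¹) : bolzaLevel ξm ξp V (2 - 2 * β) ε ≤ ENNReal.ofReal
      (ε ^ β * (excess V Vmin β R a b x v + 2 * (√(2 * Vmin) * (((ε ^ β)⁻¹ - 1) / β)))) := by
  obtain ⟨a', b', y, w, h1, h2⟩ := h.exists_extension hR hV hm hp hβ hRε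
  have h3 := h1.smul hε
  rw [mul_inv_cancel₀ hε.ne', mul_one] at h3
  refine (bolzaLevel_le h0 hmin hV hβ1 hε h3).trans (le_of_eq ?_)
  rw [jacobiLength_smul hε, ← h2, excess, Real.inv_rpow hε.le]
  congr 1
  ring

theorem bolzaLevel_ne_top (hn : 1 ≤ n) (hξ : ξm ≠ ξp) (h0 : 0 < Vmin) (hmin : ∀ s, Vmin ≤ V s)
    (hV : Continuous V) (hm : V ξm = Vmin) (hp : V ξp = Vmin) {β : ℝ} (hβ : 0 < β) (hβ1 : β ≤ 1)
    {ε : ℝ} (hε : 0 ≤ ε) (hε1 : ε ≤ 1) : bolzaLevel ξm ξp V (2 - 2 * β) ε ≠ ⊤ := by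
  rcases hε.eq_or_lt with rfl | hε
  · rw [bolzaLevel_zero h0 hmin hV hm hp hβ hβ1]
    exact ENNReal.ofReal_ne_top
  · obtain ⟨a, b, x, v, hc⟩ := exists_competitor hn hξ
    exact ne_top_of_le_ne_top ENNReal.ofReal_ne_top
      (bolzaLevel_le_excess h0 hmin hV hm hp hβ hβ1 hε one_pos hc ((one_le_inv₀ hε).2 hε1))

theorem gammaFun_eq (h0 : 0 < Vmin) (hmin : ∀ s, Vmin ≤ V s) (hV : Continuous V)
    (hm : V ξm = Vmin) (hp : V ξp = Vmin) {β : ℝ} (hβ : 0 < β) (hβ1 : β ≤ 1) (ε : ℝ) :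
    gammaFun ξm ξp V (2 - 2 * β) ε =
      ((bolzaLevel ξm ξp V (2 - 2 * β) ε).toReal - 2 * √(2 * Vmin) / β) / ε ^ β := by
  rw [gammaFun, bolzaLevel_zero h0 hmin hV hm hp hβ hβ1, ENNReal.toReal_ofReal (by positivity)]
  congr 2
  ring

theorem gammaFun_le (h0 : 0 < Vmin) (hmin : ∀ s, Vmin ≤ V s) (hV : Continuous V)
    (hm : V ξm = Vmin) (hp : V ξp = Vmin) {β : ℝ} (hβ : 0 < β) (hβ1 : β ≤ 1) {ε : ℝ} (hε : 0 < ε)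
    (hε1 : ε ≤ 1) {R a b : ℝ} {x v : ℝ → Space n} (hR : 0 < R)
    (h : IsCompetitor ξm ξp R 1 a b x v) (hRε : R ≤ ε⁻¹) :
    gammaFun ξm ξp V (2 - 2 * β) ε ≤ excess V Vmin β R a b x v - 2 * √(2 * Vmin) / β := by
  have hεβ : 0 < ε ^ β := by positivity
  -- Ensures that the bound on the level is nonnegative, so that it passes from extended to real
  -- numbers.
  have hε1' : 1 ≤ (ε ^ β)⁻¹ := (one_le_inv₀ hεβ).2 (Real.rpow_le_one hε.le hε1 hβ.le)
  have h1 := bolzaLevel_le_excess h0 hmin hV hm hp hβ hβ1 hε hR h hRε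
  have h2 := ENNReal.toReal_le_of_le_ofReal (mul_nonneg hεβ.le (add_nonneg
    (h.excess_nonneg hR.le hV hmin hβ) (mul_nonneg zero_le_two (mul_nonneg (Real.sqrt_nonneg _)
      (div_nonneg (sub_nonneg.2 hε1') hβ.le))))) h1
  rw [gammaFun_eq h0 hmin hV hm hp hβ hβ1, div_le_iff₀ hεβ]
  refine (sub_le_sub_right h2 _).trans (le_of_eq ?_)
  field_simp
  ring

theorem le_gammaFun (hn : 1 ≤ n) (hξ : ξm ≠ ξp) (h0 : 0 < Vmin) (hmin : ∀ s, Vmin ≤ V s)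
    (hV : Continuous V) (hm : V ξm = Vmin) (hp : V ξp = Vmin) {β : ℝ} (hβ : 0 < β) (hβ1 : β ≤ 1)
    {ε : ℝ} (hε : 0 < ε) (hε1 : ε ≤ 1) :
    minExcess ξm ξp V Vmin β - 2 * √(2 * Vmin) / β ≤ gammaFun ξm ξp V (2 - 2 * β) ε := by
  have hεβ : 0 < ε ^ β := by positivity
  refine le_of_forall_pos_le_add fun η hη => ?_
  -- The tolerance `η ε^β` becomes `η` after the dilation by `1/ε`, which multiplies lengths by
  -- `ε^(-β)`.
  obtain ⟨a, b, x, v, hc, hle⟩ := exists_competitor_le h0 hmin hV hε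
    (bolzaLevel_ne_top hn hξ h0 hmin hV hm hp hβ hβ1 hε.le hε1) (mul_pos hη hεβ)
  have h1 := hc.smul (inv_pos.2 hε)
  rw [inv_mul_cancel₀ hε.ne', mul_one] at h1
  have h2 := minExcess_le hV hmin hβ (inv_pos.2 hε) h1
  rw [excess, jacobiLength_smul (inv_pos.2 hε), Real.inv_rpow hε.le] at h2
  rw [gammaFun_eq h0 hmin hV hm hp hβ hβ1]
  set m := (bolzaLevel ξm ξp V (2 - 2 * β) ε).toReal
  have h3 := mul_le_mul_of_nonneg_left hle (inv_pos.2 hεβ).le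
  have e : (m - 2 * √(2 * Vmin) / β) / ε ^ β + η = (ε ^ β)⁻¹ * (m + η * ε ^ β) -
      2 * (√(2 * Vmin) * (((ε ^ β)⁻¹ - 1) / β)) - 2 * √(2 * Vmin) / β := by
    field_simp
    ring
  rw [e]
  linarith

/-- The lower bound `le_gammaFun` already holds for every `ε ≤ 1`. For the upper one, fix a
competitor of nearly least excess: it is usable as soon as its end radius satisfies `R ≤ 1/ε`. -/
theorem tendsto_gammaFun (hn : 1 ≤ n) (hξ : ξm ≠ ξp) (h0 : 0 < Vmin) (hmin : ∀ s, Vmin ≤ V s)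
    (hV : Continuous V) (hm : V ξm = Vmin) (hp : V ξp = Vmin) {β : ℝ} (hβ : 0 < β)
    (hβ1 : β ≤ 1) : Tendsto (fun ε => gammaFun ξm ξp V (2 - 2 * β) ε) (𝓝[>] 0)
      (𝓝 (minExcess ξm ξp V Vmin β - 2 * √(2 * Vmin) / β)) := by
  refine tendsto_order.2 ⟨fun m hm' => ?_, fun m hm' => ?_⟩
  · filter_upwards [Ioc_mem_nhdsGT (zero_lt_one' ℝ)] with ε hε
    exact hm'.trans_le (le_gammaFun hn hξ h0 hmin hV hm hp hβ hβ1 hε.1 hε.2)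
  · obtain ⟨R, a, b, x, v, hR, hc, hlt⟩ := exists_excess_lt hn hξ (sub_lt_iff_lt_add.1 hm')
    filter_upwards [Ioc_mem_nhdsGT (zero_lt_one' ℝ), Ioc_mem_nhdsGT (inv_pos.2 hR)] with ε hε hε'
    exact (gammaFun_le h0 hmin hV hm hp hβ hβ1 hε.1 hε.2 hR hc
      ((le_inv_comm₀ hε.1 hR).1 hε'.2)).trans_lt (sub_lt_iff_lt_add.2 hlt)

end gamma

/-! ### Consequences in terms of the exponent `α` -/

namespace IsAdmissible

variable {n : ℕ} {ξm ξp : Sph n} {V : Sph n → ℝ} {Vmin : ℝ}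

theorem tendsto_gammaFun (h : IsAdmissible ξm ξp Vmin V) (hn : 1 ≤ n) (hξ : ξm ≠ ξp)
    (h0 : 0 < Vmin) {α : ℝ} (hα : α ∈ Ioo (0 : ℝ) 2) :
    Tendsto (fun ε => gammaFun ξm ξp V α ε) (𝓝[>] 0)
      (𝓝 (minExcess ξm ξp V Vmin ((2 - α) / 2) - 4 * √(2 * Vmin) / (2 - α))) := by
  have := _root_.tendsto_gammaFun hn hξ h0 h.le_value h.contMDiff.continuous h.value_left
    h.value_right (β := (2 - α) / 2) (by linarith [hα.2]) (by linarith [hα.1])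
  have e1 : 2 - 2 * ((2 - α) / 2) = α := by ring
  have e2 : 2 * √(2 * Vmin) / ((2 - α) / 2) = 4 * √(2 * Vmin) / (2 - α) := by
    rw [div_div_eq_mul_div]; ring
  rwa [e1, e2] at this

theorem gammaZero_eq (h : IsAdmissible ξm ξp Vmin V) (hn : 1 ≤ n) (hξ : ξm ≠ ξp)
    (h0 : 0 < Vmin) {α : ℝ} (hα : α ∈ Ioo (0 : ℝ) 2) : gammaZero ξm ξp V α =
      minExcess ξm ξp V Vmin ((2 - α) / 2) - 4 * √(2 * Vmin) / (2 - α) :=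
  (h.tendsto_gammaFun hn hξ h0 hα).limUnder_eq

/-- The formula makes sense for all `α < 2`, including `α ≤ 0`, that is `β ≥ 1`; so `α = 0` is an
interior point and the limit there is plain continuity. -/
theorem continuousOn_formula (h : IsAdmissible ξm ξp Vmin V) (hn : 1 ≤ n) (hξ : ξm ≠ ξp) :
    ContinuousOn (fun α => minExcess ξm ξp V Vmin ((2 - α) / 2) - 4 * √(2 * Vmin) / (2 - α))
      (Iio 2) := by
  have hlin : ContinuousOn (fun α : ℝ => 2 - α) (Iio 2) := by fun_prop
  refine ContinuousOn.sub ?_ (continuousOn_const.div hlin fun α hα => (sub_pos.2 hα).ne')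
  exact (minExcess_continuousOn hn hξ h.contMDiff.continuous h.le_value).comp
    (hlin.div_const 2) fun α hα => mem_Ioi.2 (half_pos (sub_pos.2 hα))

theorem tendsto_gammaZero (h : IsAdmissible ξm ξp Vmin V) (hn : 1 ≤ n) (hξ : ξm ≠ ξp)
    (h0 : 0 < Vmin) : Tendsto (fun α => gammaZero ξm ξp V α) (𝓝[>] 0)
      (𝓝 (gammaZeroZero ξm ξp V)) := by
  have hc := ((h.continuousOn_formula hn hξ).continuousAt
    (Iio_mem_nhds (show (0 : ℝ) < 2 by norm_num))).tendsto.mono_left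
      (nhdsWithin_le_nhds (s := Ioi 0))
  refine tendsto_nhds_limUnder ⟨_, hc.congr' ?_⟩
  filter_upwards [Ioo_mem_nhdsGT (show (0 : ℝ) < 2 by norm_num)] with α hα
  exact (h.gammaZero_eq hn hξ h0 hα).symm

/-- The excess term does not increase with `α`. The explicit term contributes the rate, since
`1/((2-α₁)(2-α₂)) ≥ 1/(2-α₁)²`. -/
theorem gammaZero_sub_le (h : IsAdmissible ξm ξp Vmin V) (hn : 1 ≤ n) (hξ : ξm ≠ ξp)
    (h0 : 0 < Vmin) {α₁ α₂ : ℝ} (h₁ : 0 < α₁) (h₁₂ : α₁ < α₂) (h₂ : α₂ < 2) :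
    gammaZero ξm ξp V α₂ - gammaZero ξm ξp V α₁ ≤
      -(4 * √(2 * Vmin) / (2 - α₁) ^ 2) * (α₂ - α₁) := by
  have p1 : 0 < 2 - α₁ := by linarith
  have p2 : 0 < 2 - α₂ := by linarith
  rw [h.gammaZero_eq hn hξ h0 ⟨h₁, h₁₂.trans h₂⟩, h.gammaZero_eq hn hξ h0 ⟨h₁.trans h₁₂, h₂⟩]
  have hG := minExcess_mono hn hξ h.contMDiff.continuous h.le_value
    (half_pos p2) (show (2 - α₂) / 2 ≤ (2 - α₁) / 2 by linarith)
  have hc : 0 ≤ 4 * √(2 * Vmin) := by positivity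
  have e : 4 * √(2 * Vmin) / (2 - α₂) - 4 * √(2 * Vmin) / (2 - α₁) =
      4 * √(2 * Vmin) / ((2 - α₁) * (2 - α₂)) * (α₂ - α₁) := by
    field_simp
    ring
  have hle : 4 * √(2 * Vmin) / (2 - α₁) ^ 2 * (α₂ - α₁) ≤
      4 * √(2 * Vmin) / ((2 - α₁) * (2 - α₂)) * (α₂ - α₁) := by
    refine mul_le_mul_of_nonneg_right (div_le_div_of_nonneg_left hc (mul_pos p1 p2) ?_)
      (by linarith)
    rw [sq]
    exact mul_le_mul_of_nonneg_left (by linarith) p1.le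
  linarith

/-- By monotonicity the excess term stays below its value at `β = 1`, while `4√(2Vmin)/(2-α)` blows
up. -/
theorem tendsto_gammaZero_atBot (h : IsAdmissible ξm ξp Vmin V) (hn : 1 ≤ n) (hξ : ξm ≠ ξp)
    (h0 : 0 < Vmin) : Tendsto (fun α => gammaZero ξm ξp V α) (𝓝[<] 2) atBot := by
  have hc : 0 < 4 * √(2 * Vmin) := by positivity
  have h1 : Tendsto (fun α : ℝ => 2 - α) (𝓝[<] 2) (𝓝[>] 0) := by
    refine tendsto_nhdsWithin_iff.2 ⟨?_, ?_⟩
    · have : Continuous fun α : ℝ => 2 - α := by fun_prop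
      simpa using (this.tendsto 2).mono_left (nhdsWithin_le_nhds (s := Iio 2))
    · filter_upwards [self_mem_nhdsWithin] with α hα using sub_pos.2 (mem_Iio.1 hα)
  have h2 : Tendsto (fun α : ℝ => 4 * √(2 * Vmin) * (2 - α)⁻¹) (𝓝[<] 2) atTop :=
    (tendsto_inv_nhdsGT_zero.comp h1).const_mul_atTop hc
  have h3 : Tendsto (fun α : ℝ => minExcess ξm ξp V Vmin 1 + -(4 * √(2 * Vmin) * (2 - α)⁻¹))
      (𝓝[<] 2) atBot :=
    tendsto_atBot_add_const_left _ _ (tendsto_neg_atTop_atBot.comp h2)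
  refine tendsto_atBot_mono' _ ?_ h3
  filter_upwards [Ioo_mem_nhdsLT (show (0 : ℝ) < 2 by norm_num)] with α hα
  rw [h.gammaZero_eq hn hξ h0 hα, div_eq_mul_inv, ← sub_eq_add_neg]
  exact sub_le_sub_right (minExcess_mono hn hξ h.contMDiff.continuous h.le_value
    (by linarith [hα.2]) (by linarith [hα.1])) _

theorem existsUnique_gammaZero_eq_zero (h : IsAdmissible ξm ξp Vmin V) (hn : 1 ≤ n) (hξ : ξm ≠ ξp)
    (h0 : 0 < Vmin) (hpos : 0 < gammaZeroZero ξm ξp V) :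
    ∃! α : ℝ, α ∈ Ioo (0 : ℝ) 2 ∧ gammaZero ξm ξp V α = 0 := by
  have two_pos : (0 : ℝ) < 2 := by norm_num
  have hanti : ∀ α₁ ∈ Ioo (0 : ℝ) 2, ∀ α₂ ∈ Ioo (0 : ℝ) 2, α₁ < α₂ →
      gammaZero ξm ξp V α₂ < gammaZero ξm ξp V α₁ := by
    intro α₁ h₁ α₂ h₂ hlt
    have := h.gammaZero_sub_le hn hξ h0 h₁.1 hlt h₂.2
    have p1 : 0 < 2 - α₁ := by linarith [h₁.2]
    have p2 : 0 < α₂ - α₁ := by linarith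
    have : 0 < 4 * √(2 * Vmin) / (2 - α₁) ^ 2 * (α₂ - α₁) := by positivity
    linarith
  obtain ⟨α₁, hα₁, h₁⟩ := (((h.tendsto_gammaZero hn hξ h0).eventually (lt_mem_nhds hpos)).and
    (Ioo_mem_nhdsGT two_pos)).exists
  obtain ⟨α₂, hα₂, h₂⟩ := (((h.tendsto_gammaZero_atBot hn hξ h0).eventually
    (eventually_lt_atBot 0)).and (Ioo_mem_nhdsLT two_pos)).exists
  -- The function is positive at `α₁`, negative at `α₂`, and strictly decreasing.
  have hle : α₁ ≤ α₂ := by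
    by_contra hlt
    have := hanti α₂ h₂ α₁ h₁ (not_le.1 hlt)
    linarith
  have hsub : Icc α₁ α₂ ⊆ Ioo 0 2 := fun t ht => ⟨h₁.1.trans_le ht.1, ht.2.trans_lt h₂.2⟩
  have hcont : ContinuousOn (fun α => gammaZero ξm ξp V α) (Icc α₁ α₂) :=
    ((h.continuousOn_formula hn hξ).mono fun t ht => (hsub ht).2).congr fun t ht =>
      h.gammaZero_eq hn hξ h0 (hsub ht)
  obtain ⟨α, hα, hz⟩ := intermediate_value_Icc' hle hcont ⟨hα₂.le, hα₁.le⟩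
  refine ⟨α, ⟨hsub hα, hz⟩, ?_⟩
  rintro α' ⟨hα', hz'⟩
  simp only at hz
  rcases lt_trichotomy α' α with hlt | heq | hlt
  · have := hanti _ hα' _ (hsub hα) hlt
    linarith
  · exact heq
  · have := hanti _ (hsub hα) _ hα' hlt
    linarith

end IsAdmissible

end

theorem mainTheorem7 {n : ℕ} (hn : 1 ≤ n) (ξm ξp : Sph n) (hξ : ξm ≠ ξp)
    (Vmin : ℝ) (hVmin : 0 < Vmin) :
    -- all the quantities are well defined and finite
    (∀ V : Sph n → ℝ, IsAdmissible ξm ξp Vmin V →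
      (∀ α ∈ Ioo (0 : ℝ) 2, ∀ ε ∈ Icc (0 : ℝ) 1, bolzaLevel ξm ξp V α ε ≠ ⊤) ∧
      (∀ α ∈ Ioo (0 : ℝ) 2,
        Tendsto (fun ε => gammaFun ξm ξp V α ε) (𝓝[>] (0 : ℝ)) (𝓝 (gammaZero ξm ξp V α))) ∧
      Tendsto (fun α => gammaZero ξm ξp V α) (𝓝[>] (0 : ℝ)) (𝓝 (gammaZeroZero ξm ξp V))) ∧
    -- strict monotonicity in the exponent, with a rate
    (∀ V : Sph n → ℝ, IsAdmissible ξm ξp Vmin V →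
      ∀ α₁ α₂ : ℝ, 0 < α₁ → α₁ < α₂ → α₂ < 2 →
        gammaZero ξm ξp V α₂ - gammaZero ξm ξp V α₁ ≤
          -(4 * √(2 * Vmin) / (2 - α₁) ^ 2) * (α₂ - α₁)) ∧
    -- the limit at `2`
    (∀ V : Sph n → ℝ, IsAdmissible ξm ξp Vmin V →
      Tendsto (fun α => gammaZero ξm ξp V α) (𝓝[<] (2 : ℝ)) atBot) ∧
    -- existence and uniqueness of the critical exponent
    (∀ V ∈ SigmaSet ξm ξp Vmin,
      ∃! α : ℝ, α ∈ Ioo (0 : ℝ) 2 ∧ gammaZero ξm ξp V α = 0) := by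
  refine ⟨fun V h => ⟨fun α hα ε hε => ?_, fun α hα => ?_, h.tendsto_gammaZero hn hξ hVmin⟩,
    fun V h α₁ α₂ h₁ h₁₂ h₂ => h.gammaZero_sub_le hn hξ hVmin h₁ h₁₂ h₂,
    fun V h => h.tendsto_gammaZero_atBot hn hξ hVmin,
    fun V h => h.1.existsUnique_gammaZero_eq_zero hn hξ hVmin h.2⟩
  · have := bolzaLevel_ne_top hn hξ hVmin h.le_value h.contMDiff.continuous h.value_left
      h.value_right (β := (2 - α) / 2) (by linarith [hα.2]) (by linarith [hα.1]) hε.1 hε.2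
    have e : 2 - 2 * ((2 - α) / 2) = α := by ring
    rwa [e] at this
  · rw [h.gammaZero_eq hn hξ hVmin hα]
    exact h.tendsto_gammaFun hn hξ hVmin hα
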